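/- Let $V$ be a finite non-empty set, $n=|V|$, $p\in(0,1]$, $q\in[0,1)$, and let $\theta>0$ satisfy $\max\{p,1-q\}\ge\theta/n$. The edge-Markovian graph $G_0,G_1,G_2,\dots$ on $V$ starts from an arbitrary simple graph $G_0$; given $G_t$ (and the whole past), the pairs of distinct vertices evolve independently of each other: a pair that is not an edge of $G_t$ is an edge of $G_{t+1}$ with probability $p$, and an edge of $G_t$ is not an edge of $G_{t+1}$ with probability $q$. A random matching algorithm starts from an arbitrary token configuration $\Gamma_0\in\mathbb N^V$. At each time $t=0,1,2,\dots$ it draws a random matching $M_t$ of $G_t$ from a distribution $\mathcal D_t$ that may depend on $G_t$ and on the history $\mathcal E_t=\bigl((\Gamma_0,G_0,M_0),\dots,(\Gamma_{t-1},G_{t-1},M_{t-1}),\Gamma_t\bigr)$. Then, independently for each edge $\{u,v\}\in M_t$, the pair $(\Gamma_{t+1}(v),\Gamma_{t+1}(u))$ is set to $\bigl(\lceil\frac{\Gamma_t(v)+\Gamma_t(u)}2\rceil,\lfloor\frac{\Gamma_t(v)+\Gamma_t(u)}2\rfloor\bigr)$ or to $\bigl(\lfloor\frac{\Gamma_t(v)+\Gamma_t(u)}2\rfloor,\lceil\frac{\Gamma_t(v)+\Gamma_t(u)}2\rceil\bigr)$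 with probability $1/2$ each, and $\Gamma_{t+1}(w)=\Gamma_t(w)$ for every unmatched vertex $w$. Given the past and $\Gamma_{t+1}$, the graph $G_{t+1}$ depends only on $G_t$. Let $0<F\le1$. The algorithm is $F$-fair if $$\Pr\bigl[\{u,v\}\in M_t\mid G_t=G,\ \mathcal E_t=h\bigr]\ \ge\ \frac{F}{\max\{\deg_G(u),\deg_G(v)\}}$$ for every time $t$, every history $h$, every graph $G$ on $V$ and every edge $\{u,v\}$ of $G$, where the left-hand side is the probability under the distribution $\mathcal D_t$ that the algorithm uses for $h$ and $G$. Put $\mu=\frac1n\sum_{v\in V}\Gamma_0(v)$, $m=\lceil\mu-\frac12\rceil$, $\Delta=\max_{v}\Gamma_0(v)-\min_{v}\Gamma_0(v)$, $r=\max\bigl\{\frac p{1-q},\frac{1-q}p\bigr\}$, and let $$T_{\mathrm{bal}}=\min\{t\ge0:\ \Gamma_t(v)\in\{m-1,m,m+1\}\text{ for all }v\in V\}$$ ($\infty$ if there is no such $t$). **Theorem.** If the random matching algorithm is $F$-fair, then for every $0<\varepsilon<1/4$ $$\Pr\left[T_{\mathrm{bal}}\le\frac{c\,r\log\left(\frac{\Delta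 n}{\varepsilon}\right)}{F}\right]\ge1-\varepsilon,\qquad c=\frac{91}{c_*(\theta)},\quad c_*(\theta)=\frac{\left(1-e^{-\theta/3}\right)^2}{2+\frac1\theta}.$$ If $\Delta=0$, the bound on $T_{\mathrm{bal}}$ is to be read as $0$. -/

import Mathlib

open MeasureTheory ProbabilityTheory

namespace LoadBalancing

/-! ### Edge-Markovian graphs -/

/-- The one-step transition probability of the indicator of a vertex pair: `present` says whether
the pair is an edge now, `next` whether it is an edge at the following time.  An absent pair
appears with probability `p`, and a present one disappears with probability `q`. -/
noncomputable def pairProb (p q : unitInterval) (present next : Bool) : ENNReal :=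
  match present, next with
  | false, false => ENNReal.ofReal (1 - p)
  | false, true => ENNReal.ofReal p
  | true, false => ENNReal.ofReal q
  | true, true => ENNReal.ofReal (1 - q)

theorem sum_pairProb (p q : unitInterval) (present : Bool) :
    ∑ next : Bool, pairProb p q present next = 1 := by
  have hp := p.2
  have hq := q.2
  cases present
  · simp only [Fintype.sum_bool, pairProb]
    rw [← ENNReal.ofReal_add hp.1 (sub_nonneg.2 hp.2)]
    simp
  · simp only [Fintype.sum_bool, pairProb]
    rw [← ENNReal.ofReal_add (sub_nonneg.2 hq.2) hq.1]
    simp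

open scoped Classical in
/-- The law of the indicators of all unordered pairs of distinct vertices at the following time,
when the current graph is `G`: the pairs evolve independently of each other. -/
noncomputable def nextPairs {V : Type*} [Fintype V] (p q : unitInterval) (G : SimpleGraph V) :
    PMF ({e : Sym2 V // ¬ e.IsDiag} → Bool) :=
  PMF.ofFintype (fun b => ∏ e, pairProb p q (decide (e.1 ∈ G.edgeSet)) (b e)) (by
    have h := Finset.prod_univ_sum
      (fun _ : {e : Sym2 V // ¬ e.IsDiag} => (Finset.univ : Finset Bool))
      (fun e c => pairProb p q (decide (e.1 ∈ G.edgeSet)) c)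
    simp only [sum_pairProb, Finset.prod_const_one, Fintype.piFinset_univ] at h
    exact h.symm)

/-- The law of `G_{t+1}` given `G_t = G` in the edge-Markovian graph with parameters `p`, `q`. -/
noncomputable def nextGraph {V : Type*} [Fintype V] (p q : unitInterval) (G : SimpleGraph V) :
    PMF (SimpleGraph V) :=
  (nextPairs p q G).map fun b =>
    SimpleGraph.fromEdgeSet {e | ∃ h : ¬ e.IsDiag, b ⟨e, h⟩ = true}

/-! ### Random rounding along a matching -/

/-- `M` is a matching in `G`: a set of edges of `G`, no two of which share an end vertex. -/
def IsMatching {V : Type*} (G : SimpleGraph V) (M : Finset (Sym2 V)) : Prop :=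
  (∀ e ∈ M, e ∈ G.edgeSet) ∧ ∀ e ∈ M, ∀ f ∈ M, e ≠ f → ∀ v, v ∈ e → v ∉ f

open scoped Classical in
/-- Balance the loads `γ` along the matching `M`, where `up e` is the end vertex of `e` that
receives the rounded up half of the tokens on `e`; the other end receives the rounded down half.
(For natural numbers, `(m + 1) / 2` is the ceiling and `m / 2` the floor of the half of `m`.) -/
noncomputable def balance {V : Type*} (γ : V → ℕ) (M : Finset (Sym2 V))
    (up : (e : Sym2 V) → {v : V // v ∈ e}) (v : V) : ℕ :=
  if h : ∃ u, s(v, u) ∈ M then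
    if (up s(v, h.choose)).1 = v then (γ v + γ h.choose + 1) / 2 else (γ v + γ h.choose) / 2
  else γ v

instance {V : Type*} (e : Sym2 V) : Nonempty {v : V // v ∈ e} :=
  ⟨⟨_, Sym2.out_fst_mem e⟩⟩

open scoped Classical in
/-- The law of `Γ_{t+1}` given `Γ_t = γ` and `M_t = M`: independently for each pair, a fair coin
decides which of the two ends receives the rounded up half (only the pairs in `M` matter). -/
noncomputable def nextLoad {V : Type*} [Fintype V] (γ : V → ℕ) (M : Finset (Sym2 V)) :
    PMF (V → ℕ) :=
  (PMF.uniformOfFintype ((e : Sym2 V) → {v : V // v ∈ e})).map (balance γ M)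

/-! ### Random matching algorithms and their executions -/

/-- The triple `(Γ_t, G_t, M_t)`. -/
@[ext]
structure Snapshot (V : Type*) where
  load : V → ℕ
  graph : SimpleGraph V
  matching : Finset (Sym2 V)

instance {V : Type*} : MeasurableSpace (Snapshot V) := ⊤

instance {V : Type*} : DiscreteMeasurableSpace (Snapshot V) := ⟨fun _ => trivial⟩

instance {V : Type*} [Finite V] : Countable (Snapshot V) := by
  have : Function.Injective
      (fun x : Snapshot V => (x.load, x.graph, x.matching)) := by
    intro x y h
    simp only [Prod.mk.injEq] at h
    exact Snapshot.ext h.1 h.2.1 h.2.2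
  exact this.countable

/-- A random matching algorithm: `dist t past γ G` is the distribution of the matching `M_t` when
the triples at the times `0, …, t - 1` are given by `past`, and `Γ_t = γ` and `G_t = G`. -/
structure MatchingAlgorithm (V : Type*) where
  dist : (t : ℕ) → (Fin t → Snapshot V) → (V → ℕ) → SimpleGraph V → PMF (Finset (Sym2 V))
  isMatching : ∀ t past γ G, ∀ M ∈ (dist t past γ G).support, IsMatching G M

open scoped Classical in
/-- The `F`-fair condition: whatever the time, the history and the current graph `G` are, every
edge `uv` of `G` is in the random matching with probability at least `F / max(deg u, deg v)`. -/
def MatchingAlgorithm.IsFair {V : Type*} [Fintype V] (A : MatchingAlgorithm V) (F : ℝ) : Prop :=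
  ∀ (t : ℕ) (past : Fin t → Snapshot V) (γ : V → ℕ) (G : SimpleGraph V) (u v : V), G.Adj u v →
    ENNReal.ofReal (F / max (G.degree u : ℝ) (G.degree v : ℝ)) ≤
      (A.dist t past γ G).toOuterMeasure {M | s(u, v) ∈ M}

/-- The law of the triple at time `0`. -/
noncomputable def firstSnapshot {V : Type*} (A : MatchingAlgorithm V) (G₀ : SimpleGraph V)
    (Γ₀ : V → ℕ) : PMF (Snapshot V) :=
  (A.dist 0 Fin.elim0 Γ₀ G₀).map fun M => ⟨Γ₀, G₀, M⟩

/-- The law of the triple at time `t + 1`, given the triples `h` at the times `0, …, t`. -/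
noncomputable def nextSnapshot {V : Type*} [Fintype V] (p q : unitInterval)
    (A : MatchingAlgorithm V) (t : ℕ) (h : Finset.Iic t → Snapshot V) : PMF (Snapshot V) :=
  let now := h ⟨t, Finset.mem_Iic.2 le_rfl⟩
  (nextLoad now.load now.matching).bind fun γ =>
    (nextGraph p q now.graph).bind fun G =>
      (A.dist (t + 1) (fun i => h ⟨i, Finset.mem_Iic.2 (Nat.le_of_lt_succ i.2)⟩) γ G).map
        fun M => ⟨γ, G, M⟩

noncomputable def stepKernel {V : Type*} [Fintype V] (p q : unitInterval)
    (A : MatchingAlgorithm V) (t : ℕ) : Kernel (Finset.Iic t → Snapshot V) (Snapshot V) :=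
  Kernel.ofFunOfCountable fun h => (nextSnapshot p q A t h).toMeasure

instance {V : Type*} [Fintype V] (p q : unitInterval) (A : MatchingAlgorithm V) (t : ℕ) :
    IsMarkovKernel (stepKernel p q A t) :=
  ⟨fun h => PMF.toMeasure.isProbabilityMeasure (nextSnapshot p q A t h)⟩

/-- The law of the execution `(Γ_t, G_t, M_t)`, `t = 0, 1, 2, …`, of the random matching algorithm
`A` on the edge-Markovian graph with parameters `p`, `q`, started from the graph `G₀` and the
token configuration `Γ₀`. -/
noncomputable def executionLaw {V : Type*} [Fintype V] (p q : unitInterval)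
    (A : MatchingAlgorithm V) (G₀ : SimpleGraph V) (Γ₀ : V → ℕ) : Measure (ℕ → Snapshot V) :=
  Kernel.trajMeasure (X := fun _ => Snapshot V) (firstSnapshot A G₀ Γ₀).toMeasure
    (stepKernel p q A)

/-! ### Balancing time -/

/-- The average number of tokens per vertex. -/
noncomputable def average {V : Type*} [Fintype V] (γ : V → ℕ) : ℝ :=
  (∑ v, (γ v : ℝ)) / Fintype.card V

/-- Rounding to a nearest integer, `⌈x - 1/2⌉`. -/
noncomputable def nearest (x : ℝ) : ℤ := ⌈x - 1 / 2⌉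

/-- Every vertex has a load within `1` of the integer `m`. -/
def IsBalanced {V : Type*} (m : ℤ) (γ : V → ℕ) : Prop :=
  ∀ v, (γ v : ℤ) = m - 1 ∨ (γ v : ℤ) = m ∨ (γ v : ℤ) = m + 1

/-- The first time at which the configuration is balanced around the rounded average load
(`⊤` if there is no such time). -/
noncomputable def balancingTime {V : Type*} [Fintype V] (ω : ℕ → Snapshot V) : ℕ∞ :=
  sInf {T : ℕ∞ | ∃ t : ℕ, T = t ∧ IsBalanced (nearest (average (ω 0).load)) (ω t).load}

/-- The difference between the largest and the smallest load. -/
def discrepancy {V : Type*} [Fintype V] [Nonempty V] (γ : V → ℕ) : ℕ :=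
  Finset.univ.sup' Finset.univ_nonempty γ - Finset.univ.inf' Finset.univ_nonempty γ

/-- The constant `c_*(θ)`. -/
noncomputable def cStar (θ : ℝ) : ℝ := (1 - Real.exp (-θ / 3)) ^ 2 / (2 + 1 / θ)

end LoadBalancing

namespace LoadBalancing

/-! The proof is a drift argument for a potential, followed by Markov's inequality.

Matching probabilities: write P and Q for the maximum and minimum of p and 1 - q. Whatever the
present graph is, a pair uv is an edge at the next time with probability at least Q. By independence
of the pairs, given this event the expected maximum of the two degrees is at most c = 1 + 2nP.
Jensen's inequality for 1/x and fairness then show that every pair is matched with probability at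
least β = QF/c (`MatchingAlgorithm.IsFair.le_expect_nextGraph`). The new load is drawn before the
new graph and does not influence it, so this bound holds for each fixed load.

Potential: balancing a pair with difference d lowers the sum of squared deviations from μ by at
least (d² - 1)/2. Averaged over all pairs this is a constant proportion of that sum as long as it
exceeds n; below n, rounding may absorb the gain. In that regime, however, at least a fifth of the
loads are at most m and, by symmetry, at least a fifth are at least m. Matching a load above m + 1
with one that is at most m at least halves the squared excess over m + 1. `potential` combines the
two regimes, and `exists_drop` shows that its possible decreases, summed over ordered pairs, amount
to at least n/10 times its value.

Conclusion: the expected potential contracts by 1 - βn/10 per step (`expect_loadPotential_le`),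
starts at no more than 2nΔ², and is at least 1 on unbalanced configurations. Finally βn is at least
`cStar θ` · F/r (`cStar_mul_div_le`), so the stated number of steps makes the expectation at most ε
(`pow_mul_le`). -/

/-! ### Expectations under probability mass functions -/

/-- The expectation of a nonnegative function under a probability mass function. -/
noncomputable def expect {α : Type*} (P : PMF α) (f : α → ENNReal) : ENNReal :=
  ∑' a, P a * f a

theorem expect_pure {α : Type*} (a : α) (f : α → ENNReal) : expect (PMF.pure a) f = f a := by
  classical
  rw [expect, tsum_eq_single a]
  · simp
  · intro b hb
    simp [PMF.pure_apply, hb]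

theorem expect_bind {α β : Type*} (P : PMF α) (Q : α → PMF β) (f : β → ENNReal) :
    expect (P.bind Q) f = expect P fun a => expect (Q a) f := by
  simp only [expect, PMF.bind_apply, ← ENNReal.tsum_mul_right, ← ENNReal.tsum_mul_left]
  rw [ENNReal.tsum_comm]
  simp only [mul_assoc]

theorem expect_map {α β : Type*} (P : PMF α) (g : α → β) (f : β → ENNReal) :
    expect (P.map g) f = expect P fun a => f (g a) := by
  rw [PMF.map, expect_bind]
  simp only [Function.comp_apply, expect_pure]

theorem expect_add {α : Type*} (P : PMF α) (f g : α → ENNReal) :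
    expect P (fun a => f a + g a) = expect P f + expect P g := by
  simp only [expect, mul_add, ENNReal.tsum_add]

theorem expect_sum {α ι : Type*} (P : PMF α) (s : Finset ι) (f : ι → α → ENNReal) :
    expect P (fun a => ∑ i ∈ s, f i a) = ∑ i ∈ s, expect P (f i) := by
  classical
  induction s using Finset.induction_on with
  | empty => simp [expect]
  | insert i s hi ih => simp only [Finset.sum_insert hi, expect_add, ih]

theorem expect_const_mul {α : Type*} (P : PMF α) (c : ENNReal) (f : α → ENNReal) :
    expect P (fun a => c * f a) = c * expect P f := by
  simp only [expect, ← ENNReal.tsum_mul_left]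
  exact tsum_congr fun a => mul_left_comm _ _ _

theorem expect_const {α : Type*} (P : PMF α) (c : ENNReal) : expect P (fun _ => c) = c := by
  rw [expect, ENNReal.tsum_mul_right, P.tsum_coe, one_mul]

theorem expect_mono {α : Type*} {P : PMF α} {f g : α → ENNReal}
    (h : ∀ a ∈ P.support, f a ≤ g a) : expect P f ≤ expect P g := by
  refine ENNReal.tsum_le_tsum fun a => ?_
  by_cases ha : P a = 0
  · simp [ha]
  · exact mul_le_mul_right (h a ((P.mem_support_iff a).2 ha)) _

theorem expect_indicator {α : Type*} (P : PMF α) (s : Set α) [DecidablePred (· ∈ s)]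
    (c : ENNReal) : expect P (fun a => if a ∈ s then c else 0) = c * P.toOuterMeasure s := by
  rw [PMF.toOuterMeasure_apply, expect, ← ENNReal.tsum_mul_left]
  refine tsum_congr fun a => ?_
  by_cases h : a ∈ s <;> simp [h, mul_comm]

theorem lintegral_toMeasure {α : Type*} [Countable α] [MeasurableSpace α]
    [DiscreteMeasurableSpace α] (P : PMF α) (f : α → ENNReal) :
    ∫⁻ a, f a ∂P.toMeasure = expect P f := by
  rw [lintegral_countable', expect]
  refine tsum_congr fun a => ?_
  rw [PMF.toMeasure_apply_singleton _ _ (measurableSet_singleton a), mul_comm]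

/-! ### Expectations under the law of the execution -/

section Execution

variable {V : Type*} [Fintype V] (p q : unitInterval) (A : MatchingAlgorithm V)
  (G₀ : SimpleGraph V) (Γ₀ : V → ℕ)

instance : IsProbabilityMeasure (executionLaw p q A G₀ Γ₀) := by
  have := PMF.toMeasure.isProbabilityMeasure (firstSnapshot A G₀ Γ₀)
  unfold executionLaw
  infer_instance

theorem lintegral_executionLaw_zero (f : Snapshot V → ENNReal) :
    ∫⁻ ω, f (ω 0) ∂executionLaw p q A G₀ Γ₀ = expect (firstSnapshot A G₀ Γ₀) f := by
  have := PMF.toMeasure.isProbabilityMeasure (firstSnapshot A G₀ Γ₀)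
  have hf : Measurable f := measurable_from_top
  have h : (executionLaw p q A G₀ Γ₀).map (fun ω => ω 0) =
      (firstSnapshot A G₀ Γ₀).toMeasure := by
    have h1 : (executionLaw p q A G₀ Γ₀).map (Preorder.frestrictLe 0) =
        (firstSnapshot A G₀ Γ₀).toMeasure.map
          (MeasurableEquiv.piUnique (fun i : Finset.Iic 0 => Snapshot V)).symm := by
      rw [executionLaw, Kernel.trajMeasure, Measure.map_comp _ _ (by fun_prop),
        Kernel.traj_map_frestrictLe, Kernel.partialTraj_self, Measure.id_comp]
    have h2 : (fun ω : ℕ → Snapshot V => ω 0) =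
        (fun x : Finset.Iic 0 → Snapshot V => x ⟨0, by simp⟩) ∘ Preorder.frestrictLe 0 := rfl
    rw [h2, ← Measure.map_map (by fun_prop) (by fun_prop), h1,
      Measure.map_map (by fun_prop) (by fun_prop)]
    exact Measure.map_id
  rw [← lintegral_toMeasure, ← h, lintegral_map hf (by fun_prop)]

theorem lintegral_executionLaw_succ (t : ℕ) (f : Snapshot V → ENNReal) :
    ∫⁻ ω, f (ω (t + 1)) ∂executionLaw p q A G₀ Γ₀ =
      ∫⁻ ω, expect (nextSnapshot p q A t (Preorder.frestrictLe t ω)) f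
        ∂executionLaw p q A G₀ Γ₀ := by
  have := PMF.toMeasure.isProbabilityMeasure (firstSnapshot A G₀ Γ₀)
  have hf : Measurable f := measurable_from_top
  have h := Kernel.map_frestrictLe_trajMeasure_compProd_eq_map_trajMeasure
    (X := fun _ => Snapshot V) (μ₀ := (firstSnapshot A G₀ Γ₀).toMeasure)
    (κ := stepKernel p q A) (a := t)
  have h' := congrArg (fun ν => ∫⁻ x, f x.2 ∂ν) h
  beta_reduce at h'
  rw [lintegral_map (by fun_prop) (by fun_prop),
    Measure.lintegral_compProd (by fun_prop)] at h'
  rw [lintegral_map (f := fun a => ∫⁻ b, f b ∂stepKernel p q A t a) .of_discrete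
    (by fun_prop)] at h'
  rw [executionLaw, ← h']
  refine lintegral_congr fun ω => ?_
  exact lintegral_toMeasure (nextSnapshot p q A t (Preorder.frestrictLe t ω)) f

/-- If the expected value of a potential `W` of the load does not increase in the first step and
decreases by the factor `ρ` in all later steps, then it decays geometrically. -/
theorem lintegral_load_le (W : (V → ℕ) → ENNReal) (ρ : ENNReal)
    (hfirst : ∀ γ G M, IsMatching G M → expect (nextLoad γ M) W ≤ W γ)
    (hstep : ∀ t past γ H, (expect (nextGraph p q H) fun G =>
      expect (A.dist (t + 1) past γ G) fun M => expect (nextLoad γ M) W) ≤ ρ * W γ) (t : ℕ) :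
    ∫⁻ ω, W (ω (t + 1)).load ∂executionLaw p q A G₀ Γ₀ ≤ ρ ^ t * W Γ₀ := by
  -- The induction follows the potential after averaging over the rounding along the matching of
  -- time t. Time 0 only contributes non-increase because the initial graph is arbitrary, which is
  -- why t + 1 steps give the power t.
  have key : ∀ t, ∫⁻ ω, expect (nextLoad (ω t).load (ω t).matching) W
      ∂executionLaw p q A G₀ Γ₀ ≤ ρ ^ t * W Γ₀ := by
    intro t
    induction t with
    | zero =>
      rw [lintegral_executionLaw_zero p q A G₀ Γ₀ fun s => expect (nextLoad s.load s.matching) W,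
        firstSnapshot, expect_map, pow_zero, one_mul]
      calc _ ≤ expect (A.dist 0 Fin.elim0 Γ₀ G₀) fun _ => W Γ₀ :=
            expect_mono fun M hM => hfirst _ _ _ (A.isMatching _ _ _ _ M hM)
        _ = W Γ₀ := expect_const _ _
    | succ t ih =>
      rw [lintegral_executionLaw_succ p q A G₀ Γ₀ t
        fun s => expect (nextLoad s.load s.matching) W]
      calc _ ≤ ∫⁻ ω, ρ * expect (nextLoad (ω t).load (ω t).matching) W
            ∂executionLaw p q A G₀ Γ₀ := by
            refine lintegral_mono fun ω => ?_
            simp only [nextSnapshot, expect_bind, expect_map]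
            rw [← expect_const_mul]
            exact expect_mono fun γ _ => hstep _ _ _ _
        _ = ρ * ∫⁻ ω, expect (nextLoad (ω t).load (ω t).matching) W
            ∂executionLaw p q A G₀ Γ₀ := by
            refine lintegral_const_mul _ ?_
            exact (measurable_from_top (f := fun s : Snapshot V =>
              expect (nextLoad s.load s.matching) W)).comp (measurable_pi_apply t)
        _ ≤ ρ * (ρ ^ t * W Γ₀) := mul_le_mul_right ih _
        _ = ρ ^ (t + 1) * W Γ₀ := by ring
  refine le_trans (le_of_eq ?_) (key t)
  rw [lintegral_executionLaw_succ p q A G₀ Γ₀ t fun s => W s.load]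
  refine lintegral_congr fun ω => ?_
  simp only [nextSnapshot, expect_bind, expect_map, expect_const]
  rfl

theorem ae_load_zero : ∀ᵐ ω ∂executionLaw p q A G₀ Γ₀, (ω 0).load = Γ₀ := by
  classical
  have h := lintegral_executionLaw_zero p q A G₀ Γ₀ fun s => if s.load = Γ₀ then 0 else 1
  rw [firstSnapshot, expect_map] at h
  simp only [if_true, expect_const] at h
  rw [lintegral_eq_zero_iff] at h
  · filter_upwards [h] with ω hω
    by_contra hne
    simp [hne] at hω
  · exact (measurable_from_top (f := fun s : Snapshot V =>
      if s.load = Γ₀ then (0 : ENNReal) else 1)).comp (measurable_pi_apply 0)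

end Execution

/-! ### Edges of the edge-Markovian graph after one step -/

section EdgeMarkovian

open scoped Classical in
/-- The indicator of the adjacency of two vertices. -/
noncomputable def adjInd {V : Type*} (u v : V) (G : SimpleGraph V) : ENNReal :=
  if G.Adj u v then 1 else 0

open scoped Classical in
/-- The probability that the pair `uv` is an edge at the following time. -/
noncomputable def edgeProb {V : Type*} (p q : unitInterval) (H : SimpleGraph V) (u v : V) :
    ENNReal :=
  pairProb p q (decide (s(u, v) ∈ H.edgeSet)) true

variable {V : Type*} {p q : unitInterval} {H : SimpleGraph V}

open scoped Classical in
theorem adjInd_fromEdgeSet {u v : V} (huv : u ≠ v) (b : {e : Sym2 V // ¬ e.IsDiag} → Bool) :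
    adjInd u v (SimpleGraph.fromEdgeSet {e | ∃ h : ¬ e.IsDiag, b ⟨e, h⟩ = true}) =
      if b ⟨s(u, v), by simpa using huv⟩ = true then 1 else 0 := by
  simp [adjInd, huv]

theorem edgeProb_le (u v : V) :
    edgeProb p q H u v ≤ ENNReal.ofReal (max (p : ℝ) (1 - q)) := by
  classical
  unfold edgeProb
  by_cases h : s(u, v) ∈ H.edgeSet <;> simp only [h, decide_true, decide_false, pairProb] <;>
    apply ENNReal.ofReal_le_ofReal
  · exact le_max_right _ _
  · exact le_max_left _ _

theorem le_edgeProb (u v : V) :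
    ENNReal.ofReal (min (p : ℝ) (1 - q)) ≤ edgeProb p q H u v := by
  classical
  unfold edgeProb
  by_cases h : s(u, v) ∈ H.edgeSet <;> simp only [h, decide_true, decide_false, pairProb] <;>
    apply ENNReal.ofReal_le_ofReal
  · exact min_le_right _ _
  · exact min_le_left _ _

variable [Fintype V]

open scoped Classical in
theorem expect_nextPairs_prod (h : {e : Sym2 V // ¬ e.IsDiag} → Bool → ENNReal) :
    expect (nextPairs p q H) (fun b => ∏ e, h e (b e)) =
      ∏ e, ∑ c, pairProb p q (decide (e.1 ∈ H.edgeSet)) c * h e c := by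
  rw [Finset.prod_univ_sum, Fintype.piFinset_univ, expect, tsum_fintype]
  refine Finset.sum_congr rfl fun b _ => ?_
  rw [Finset.prod_mul_distrib]
  rfl

-- Independence of the pairs: the factors outside `S` sum to one.
open scoped Classical in
theorem expect_nextPairs_finset (S : Finset {e : Sym2 V // ¬ e.IsDiag}) :
    expect (nextPairs p q H) (fun b => ∏ e ∈ S, if b e = true then 1 else 0) =
      ∏ e ∈ S, pairProb p q (decide (e.1 ∈ H.edgeSet)) true := by
  have h := expect_nextPairs_prod (p := p) (q := q) (H := H)
    fun e c => if e ∈ S then (if c = true then 1 else 0) else 1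
  have h1 : ∀ b : {e : Sym2 V // ¬ e.IsDiag} → Bool,
      (∏ e, if e ∈ S then (if b e = true then (1 : ENNReal) else 0) else 1) =
        ∏ e ∈ S, if b e = true then 1 else 0 := by
    intro b
    rw [Finset.prod_ite_mem, Finset.univ_inter]
  simp only [h1] at h
  rw [h, ← Finset.univ_inter S, ← Finset.prod_ite_mem]
  refine Finset.prod_congr rfl fun e _ => ?_
  by_cases he : e ∈ S
  · simp [he]
  · simpa [he] using sum_pairProb p q (decide (e.1 ∈ H.edgeSet))

theorem expect_adjInd {u v : V} (huv : u ≠ v) :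
    expect (nextGraph p q H) (adjInd u v) = edgeProb p q H u v := by
  classical
  rw [nextGraph, expect_map]
  simp only [adjInd_fromEdgeSet huv]
  have h := expect_nextPairs_finset (p := p) (q := q) (H := H) {⟨s(u, v), by simpa using huv⟩}
  simp only [Finset.prod_singleton] at h
  exact h

theorem expect_adjInd_mul {u v x y : V} (huv : u ≠ v) (hxy : x ≠ y) (hne : s(u, v) ≠ s(x, y)) :
    expect (nextGraph p q H) (fun G => adjInd u v G * adjInd x y G) =
      edgeProb p q H u v * edgeProb p q H x y := by
  classical
  rw [nextGraph, expect_map]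
  simp only [adjInd_fromEdgeSet huv, adjInd_fromEdgeSet hxy]
  have h := expect_nextPairs_finset (p := p) (q := q) (H := H)
    {⟨s(u, v), by simpa using huv⟩, ⟨s(x, y), by simpa using hxy⟩}
  have hne' : (⟨s(u, v), by simpa using huv⟩ : {e : Sym2 V // ¬ e.IsDiag}) ≠
      ⟨s(x, y), by simpa using hxy⟩ := fun h => hne (congrArg Subtype.val h)
  simp only [Finset.prod_pair hne'] at h
  exact h

-- The possible neighbour v is counted separately as 1, so that the remaining indicators are
-- independent of the pair uv.
open scoped Classical in
theorem degree_le_one_add_sum {G : SimpleGraph V} (u v : V) :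
    (G.degree u : ENNReal) ≤ 1 + ∑ w ∈ Finset.univ.filter (fun w => w ≠ u ∧ w ≠ v),
      adjInd u w G := by
  have h : G.degree u ≤ 1 + ((Finset.univ.filter fun w => w ≠ u ∧ w ≠ v).filter
      fun w => G.Adj u w).card := by
    rw [← G.card_neighborFinset_eq_degree u, add_comm]
    refine le_trans (Finset.card_le_card ?_) (Finset.card_insert_le v _)
    intro w hw
    rw [SimpleGraph.mem_neighborFinset] at hw
    by_cases hwv : w = v
    · simp [hwv]
    · simp [hwv, hw, hw.ne']
  simp only [adjInd, Finset.sum_ite, Finset.sum_const_zero, add_zero, Finset.sum_const,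
    nsmul_eq_mul, mul_one]
  exact_mod_cast h

-- The tangent to F/x at x = c lies below the graph, since (c - D)² ≥ 0. This replaces Jensen's
-- inequality by a bound linear in the degrees, and the maximum of the degrees is bounded by their
-- sum with the common edge uv counted once.
open scoped Classical in
theorem le_div_max_degree_add {G : SimpleGraph V} {u v : V} (huv : G.Adj u v) {F c : ℝ}
    (hF : 0 ≤ F) (hc : 0 < c) :
    ENNReal.ofReal (2 * F / c) ≤
      ENNReal.ofReal (F / max (G.degree u : ℝ) (G.degree v : ℝ)) +
        ENNReal.ofReal (F / c ^ 2) *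
          (1 + ∑ w ∈ Finset.univ.filter (fun w => w ≠ u ∧ w ≠ v),
            (adjInd u w G + adjInd v w G)) := by
  set D : ℝ := max (G.degree u : ℝ) (G.degree v : ℝ) with hD
  have hD1 : 1 ≤ D := by
    have h : 0 < G.degree u := by
      rw [← G.card_neighborFinset_eq_degree u]
      exact Finset.card_pos.2 ⟨v, by simpa using huv⟩
    exact le_max_of_le_left (by exact_mod_cast h)
  have hD0 : 0 < D := by linarith
  have hreal : 2 * F / c ≤ F / D + F / c ^ 2 * D := by
    have h : F / D + F / c ^ 2 * D - 2 * F / c = F * (c - D) ^ 2 / (D * c ^ 2) := by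
      field_simp
      ring
    have : 0 ≤ F * (c - D) ^ 2 / (D * c ^ 2) := by positivity
    linarith
  refine (ENNReal.ofReal_le_ofReal hreal).trans ?_
  rw [ENNReal.ofReal_add (by positivity) (by positivity), ENNReal.ofReal_mul (by positivity)]
  gcongr
  rw [hD, ENNReal.ofReal_max, ENNReal.ofReal_natCast, ENNReal.ofReal_natCast]
  refine max_le ?_ ?_
  · refine (degree_le_one_add_sum u v).trans ?_
    gcongr
    exact le_self_add
  · refine (degree_le_one_add_sum v u).trans ?_
    simp only [and_comm]
    gcongr
    exact le_add_self

open scoped Classical in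
/-- In the graph after one step, the expectation of `F / max (deg u) (deg v)` on the event that
`uv` is an edge is bounded below, whatever the present graph is. -/
theorem le_expect_div_max_degree {u v : V} (huv : u ≠ v) {F : ℝ} (hF : 0 ≤ F) :
    ENNReal.ofReal (min (p : ℝ) (1 - q) *
        (F / (1 + 2 * Fintype.card V * max (p : ℝ) (1 - q)))) ≤
      expect (nextGraph p q H) fun G =>
        if G.Adj u v then ENNReal.ofReal (F / max (G.degree u : ℝ) (G.degree v : ℝ)) else 0 := by
  have hP : 0 ≤ max (p : ℝ) (1 - q) := le_max_of_le_left p.2.1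
  set P : ℝ := max (p : ℝ) (1 - q) with hPdef
  -- The tangent point is an upper bound for the expected maximum degree given that uv is an edge.
  set c : ℝ := 1 + 2 * Fintype.card V * P with hc
  have hc0 : 0 < c := by positivity
  set S : Finset V := Finset.univ.filter fun w => w ≠ u ∧ w ≠ v with hS
  set X := expect (nextGraph p q H) fun G =>
        if G.Adj u v then ENNReal.ofReal (F / max (G.degree u : ℝ) (G.degree v : ℝ)) else 0
    with hX
  set π := edgeProb p q H u v with hπ
  have hsum : (1 + ∑ w ∈ S, (edgeProb p q H u w + edgeProb p q H v w)) ≤ ENNReal.ofReal c := by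
    calc _ ≤ 1 + ∑ w ∈ S, (ENNReal.ofReal P + ENNReal.ofReal P) := by
          gcongr <;> exact edgeProb_le _ _
      _ ≤ 1 + ∑ w : V, (ENNReal.ofReal P + ENNReal.ofReal P) := by
          gcongr
          exact Finset.subset_univ _
      _ = ENNReal.ofReal c := by
          rw [hc, ENNReal.ofReal_add zero_le_one (by positivity), ENNReal.ofReal_one,
            ← ENNReal.ofReal_add hP hP, Finset.sum_const, nsmul_eq_mul, Finset.card_univ,
            ← ENNReal.ofReal_natCast, ← ENNReal.ofReal_mul (by positivity)]
          congr 2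
          ring
  have hmain : ENNReal.ofReal (2 * F / c) * π ≤ X + ENNReal.ofReal (F / c ^ 2) *
      (π + ∑ w ∈ S, (π * edgeProb p q H u w + π * edgeProb p q H v w)) := by
    calc _ = expect (nextGraph p q H) fun G => ENNReal.ofReal (2 * F / c) * adjInd u v G := by
          rw [expect_const_mul, expect_adjInd huv]
      _ ≤ expect (nextGraph p q H) fun G =>
          (if G.Adj u v then ENNReal.ofReal (F / max (G.degree u : ℝ) (G.degree v : ℝ)) else 0) +
          ENNReal.ofReal (F / c ^ 2) * (adjInd u v G +
            ∑ w ∈ S, (adjInd u v G * adjInd u w G + adjInd u v G * adjInd v w G)) := by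
          refine expect_mono fun G _ => ?_
          by_cases h : G.Adj u v
          · have := le_div_max_degree_add h hF hc0
            simpa [adjInd, h] using this
          · simp [adjInd, h]
      _ = _ := by
          rw [expect_add, expect_const_mul, expect_add, expect_sum, expect_adjInd huv]
          congr 3
          refine Finset.sum_congr rfl fun w hw => ?_
          simp only [hS, Finset.mem_filter, Finset.mem_univ, true_and] at hw
          rw [expect_add, expect_adjInd_mul huv hw.1.symm, expect_adjInd_mul huv hw.2.symm]
          · simp [huv, hw.1.symm, hw.2.symm]
          · simp [hw.1.symm, hw.2.symm]
  have hbound : ENNReal.ofReal (F / c ^ 2) *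
      (π + ∑ w ∈ S, (π * edgeProb p q H u w + π * edgeProb p q H v w)) ≤
      ENNReal.ofReal (F / c) * π := by
    simp only [← mul_add, ← Finset.mul_sum]
    nth_rw 1 [← mul_one π]
    rw [← mul_add]
    calc _ ≤ ENNReal.ofReal (F / c ^ 2) * (π * ENNReal.ofReal c) := by gcongr
      _ = ENNReal.ofReal (F / c ^ 2 * c) * π := by
          rw [ENNReal.ofReal_mul (by positivity)]
          ring
      _ = _ := by
          congr 2
          field_simp
  have hπtop : π ≠ ⊤ := ne_top_of_le_ne_top ENNReal.ofReal_ne_top (edgeProb_le u v)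
  have hfin : ENNReal.ofReal (F / c) * π ≠ ⊤ := ENNReal.mul_ne_top ENNReal.ofReal_ne_top hπtop
  -- Of the tangent's 2F/c, one F/c pays for the degree term; cancelling it requires finiteness.
  have hle : ENNReal.ofReal (F / c) * π ≤ X := by
    have h2 : ENNReal.ofReal (2 * F / c) * π =
        ENNReal.ofReal (F / c) * π + ENNReal.ofReal (F / c) * π := by
      rw [← add_mul, ← ENNReal.ofReal_add (by positivity) (by positivity)]
      congr 2
      ring
    rw [h2] at hmain
    exact (ENNReal.add_le_add_iff_right hfin).1 (hmain.trans (by gcongr))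
  refine le_trans ?_ hle
  rw [mul_comm, ENNReal.ofReal_mul (by positivity)]
  gcongr
  exact le_edgeProb u v

/-- A fair algorithm matches every pair of vertices with a probability that is bounded below. -/
theorem MatchingAlgorithm.IsFair.le_expect_nextGraph {A : MatchingAlgorithm V} {F : ℝ}
    (hA : A.IsFair F) (hF : 0 ≤ F) (t : ℕ) (past : Fin t → Snapshot V) (γ : V → ℕ)
    {u v : V} (huv : u ≠ v) :
    ENNReal.ofReal (min (p : ℝ) (1 - q) *
        (F / (1 + 2 * Fintype.card V * max (p : ℝ) (1 - q)))) ≤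
      expect (nextGraph p q H) fun G =>
        (A.dist t past γ G).toOuterMeasure {M | s(u, v) ∈ M} := by
  classical
  refine (le_expect_div_max_degree huv hF).trans (expect_mono fun G _ => ?_)
  split_ifs with h
  · convert hA t past γ G u v h
  · exact zero_le

end EdgeMarkovian

/-! ### Balancing along a matching -/

section Balance

variable {V : Type*}

/-- A matching is encoded by the involution exchanging matched vertices, so that sums over vertices
can be regrouped into partner pairs by reindexing. -/
theorem IsMatching.exists_partner {G : SimpleGraph V} {M : Finset (Sym2 V)}
    (hM : IsMatching G M) : ∃ σ : Equiv.Perm V,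
      (∀ v u, s(v, u) ∈ M ↔ u = σ v ∧ σ v ≠ v) ∧
      ∀ (γ : V → ℕ) (up : (e : Sym2 V) → {v : V // v ∈ e}) (v : V),
        (σ v = v ∧ balance γ M up v = γ v) ∨
        (balance γ M up v = (γ v + γ (σ v) + 1) / 2 ∧
          balance γ M up (σ v) = (γ v + γ (σ v)) / 2) ∨
        (balance γ M up v = (γ v + γ (σ v)) / 2 ∧
          balance γ M up (σ v) = (γ v + γ (σ v) + 1) / 2) := by
  classical
  set σ : V → V := fun v => if h : ∃ u, s(v, u) ∈ M then h.choose else v with hσ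
  have huniq : ∀ v u w, s(v, u) ∈ M → s(v, w) ∈ M → u = w := by
    intro v u w hu hw
    by_contra hne
    exact hM.2 _ hu _ hw (fun h => hne (Sym2.congr_right.1 h)) v (by simp) (by simp)
  have hmem : ∀ v u, s(v, u) ∈ M → σ v = u := by
    intro v u h
    have h' : ∃ u, s(v, u) ∈ M := ⟨u, h⟩
    simp only [hσ, dif_pos h']
    exact huniq _ _ _ h'.choose_spec h
  have hne : ∀ v u, s(v, u) ∈ M → u ≠ v := fun v u h => (G.ne_of_adj (hM.1 _ h)).symm
  have hnot : ∀ v, (¬ ∃ u, s(v, u) ∈ M) → σ v = v := fun v h => by simp only [hσ, dif_neg h]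
  have hinv : Function.Involutive σ := by
    intro v
    by_cases h : ∃ u, s(v, u) ∈ M
    · obtain ⟨u, hu⟩ := h
      rw [hmem v u hu]
      exact hmem u v (by rwa [Sym2.eq_swap])
    · rw [hnot v h, hnot v h]
  refine ⟨hinv.toPerm, fun v u => ⟨fun h => ?_, fun h => ?_⟩, fun γ up v => ?_⟩
  · simp only [Function.Involutive.coe_toPerm]
    rw [hmem v u h]
    exact ⟨rfl, hne v u h⟩
  · simp only [Function.Involutive.coe_toPerm] at h
    by_contra hcon
    refine h.2 (hnot v ?_)
    rintro ⟨w, hw⟩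
    rw [h.1, hmem v w hw] at hcon
    exact hcon hw
  · simp only [Function.Involutive.coe_toPerm]
    by_cases h : ∃ u, s(v, u) ∈ M
    · right
      obtain ⟨u, hu⟩ := h
      rw [hmem v u hu]
      have hu' : s(u, v) ∈ M := by rwa [Sym2.eq_swap]
      have key : ∀ x y, s(x, y) ∈ M → balance γ M up x =
          if (up s(x, y)).1 = x then (γ x + γ y + 1) / 2 else (γ x + γ y) / 2 := by
        intro x y hxy
        have hex : ∃ y, s(x, y) ∈ M := ⟨y, hxy⟩
        have hch : hex.choose = y := huniq _ _ _ hex.choose_spec hxy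
        have hval : ∀ w, w = y →
            (if (up s(x, w)).1 = x then (γ x + γ w + 1) / 2 else (γ x + γ w) / 2) =
              if (up s(x, y)).1 = x then (γ x + γ y + 1) / 2 else (γ x + γ y) / 2 := by
          rintro w rfl
          rfl
        rw [balance, dif_pos hex]
        exact hval _ hch
      rw [key v u hu, key u v hu', Sym2.eq_swap (a := u) (b := v), add_comm (γ u) (γ v)]
      have hcase : (up s(v, u)).1 = v ∨ (up s(v, u)).1 = u :=
        Sym2.mem_iff.1 (up s(v, u)).2
      have hvu := hne v u hu
      rcases hcase with h | h
      · left
        simp [h, hvu.symm]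
      · right
        simp [h, hvu]
    · left
      exact ⟨hnot v h, by simp only [balance, dif_neg h]⟩

variable [Fintype V]

open scoped Classical in
/-- If balancing two loads decreases the sum of their `f`-values by at least `d`, then balancing
along a matching decreases the total `f`-value by at least the sum of `d` over the matching. -/
theorem IsMatching.sum_balance_add_le {G : SimpleGraph V} {M : Finset (Sym2 V)}
    (hM : IsMatching G M) (f : ℝ → ℝ) (d : ℝ → ℝ → ℝ) (γ : V → ℕ)
    (h : ∀ a b : ℕ, f ((a + b + 1) / 2 : ℕ) + f ((a + b) / 2 : ℕ) + d a b ≤ f a + f b)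
    (up : (e : Sym2 V) → {v : V // v ∈ e}) :
    ∑ v, f (balance γ M up v) + ∑ v, ∑ u, (if s(v, u) ∈ M then d (γ v) (γ u) / 2 else 0) ≤
      ∑ v, f (γ v) := by
  obtain ⟨σ, hσ, hbal⟩ := hM.exists_partner
  have h1 : ∀ v, ∑ u, (if s(v, u) ∈ M then d (γ v) (γ u) / 2 else 0) =
      if σ v ≠ v then d (γ v) (γ (σ v)) / 2 else 0 := by
    intro v
    simp only [hσ, ite_and]
    simp
  simp only [h1]
  have h2 : ∀ g : V → ℝ, ∑ v, g v = ∑ v, (g v + g (σ v)) / 2 := by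
    intro g
    rw [← Finset.sum_div, Finset.sum_add_distrib, Equiv.sum_comp σ g]
    ring
  rw [h2 fun v => f (γ v), h2 fun v => f (balance γ M up v), ← Finset.sum_add_distrib]
  refine Finset.sum_le_sum fun v _ => ?_
  have hv := h (γ v) (γ (σ v))
  rcases hbal γ up v with ⟨h3, h4⟩ | ⟨h3, h4⟩ | ⟨h3, h4⟩
  · simp [h3, h4]
  · rw [h3, h4]
    by_cases h5 : σ v = v
    · rw [h5] at h3 h4 hv ⊢
      have h6 : (γ v + γ v + 1) / 2 = γ v := by omega
      have h7 : (γ v + γ v) / 2 = γ v := by omega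
      simp [h6, h7]
    · rw [if_pos h5]
      linarith
  · rw [h3, h4]
    by_cases h5 : σ v = v
    · rw [h5] at h3 h4 hv ⊢
      have h6 : (γ v + γ v + 1) / 2 = γ v := by omega
      have h7 : (γ v + γ v) / 2 = γ v := by omega
      simp [h6, h7]
    · rw [if_pos h5]
      linarith

theorem IsMatching.average_balance {G : SimpleGraph V} {M : Finset (Sym2 V)}
    (hM : IsMatching G M) (γ : V → ℕ) (up : (e : Sym2 V) → {v : V // v ∈ e}) :
    average (balance γ M up) = average γ := by
  have key : ∀ a b : ℕ, (((a + b + 1) / 2 : ℕ) : ℝ) + ((a + b) / 2 : ℕ) = a + b := by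
    intro a b
    exact_mod_cast (by omega : (a + b + 1) / 2 + (a + b) / 2 = a + b)
  -- Conservation of tokens follows from monotonicity for the identity and for its negative.
  have h1 := hM.sum_balance_add_le (fun x => x) (fun _ _ => 0) γ
    (fun a b => by linarith [key a b]) up
  have h2 := hM.sum_balance_add_le (fun x => -x) (fun _ _ => 0) γ
    (fun a b => by linarith [key a b]) up
  simp only [zero_div, ite_self, Finset.sum_const_zero, add_zero, Finset.sum_neg_distrib,
    neg_le_neg_iff] at h1 h2
  rw [average, average, le_antisymm h1 h2]

end Balance

/-! ### Two potentials -/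

section Potential

/-- The square of the part of `x` that exceeds `m + 1`. -/
noncomputable def sqExcess (m x : ℝ) : ℝ := (max 0 (x - (m + 1))) ^ 2

/-- The square of the distance between `x` and the interval `[m - 1, m + 1]`. -/
noncomputable def sqDist (m x : ℝ) : ℝ := sqExcess m x + sqExcess (-m) (-x)

theorem sqExcess_nonneg (m x : ℝ) : 0 ≤ sqExcess m x := sq_nonneg _

theorem sqDist_nonneg (m x : ℝ) : 0 ≤ sqDist m x :=
  add_nonneg (sqExcess_nonneg _ _) (sqExcess_nonneg _ _)

theorem sqExcess_eq_zero {m x : ℝ} (h : x ≤ m + 1) : sqExcess m x = 0 := by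
  rw [sqExcess, max_eq_left (by linarith)]
  norm_num

/-- The mean lies in the interval [m - 1, m + 1], so no point is farther from the interval than from
the mean. -/
theorem sqDist_le_sq {m μ x : ℝ} (h : |μ - m| ≤ 1) : sqDist m x ≤ (x - μ) ^ 2 := by
  rw [abs_le] at h
  rw [sqDist, sqExcess, sqExcess]
  rcases le_total (x - (m + 1)) 0 with h1 | h1 <;>
    rcases le_total (-x - (-m + 1)) 0 with h2 | h2 <;>
    simp only [max_eq_left, max_eq_right, h1, h2] <;> nlinarith

theorem one_le_sqDist {m x : ℤ} (h : ¬ (x = m - 1 ∨ x = m ∨ x = m + 1)) :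
    1 ≤ sqDist m x := by
  have h' : m + 2 ≤ x ∨ x + 2 ≤ m := by omega
  rw [sqDist, sqExcess, sqExcess]
  rcases h' with h' | h'
  · have h2 : (m : ℝ) + 2 ≤ x := by exact_mod_cast h'
    have h3 : (1 : ℝ) ≤ max 0 ((x : ℝ) - (m + 1)) := le_max_of_le_right (by linarith)
    nlinarith [sq_nonneg (max 0 (-(x : ℝ) - (-m + 1)))]
  · have h2 : (x : ℝ) + 2 ≤ m := by exact_mod_cast h'
    have h3 : (1 : ℝ) ≤ max 0 (-(x : ℝ) - (-m + 1)) := le_max_of_le_right (by linarith)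
    nlinarith [sq_nonneg (max 0 ((x : ℝ) - (m + 1)))]

/-- The numbers `y`, `z` are obtained by balancing `a`, `b`. -/
structure Balances (a b y z : ℝ) : Prop where
  sum_eq : y + z = a + b
  abs_le_one : |y - z| ≤ 1
  abs_le : |y - z| ≤ |a - b|

theorem balances_natCast (a b : ℕ) :
    Balances a b ((a + b + 1) / 2 : ℕ) ((a + b) / 2 : ℕ) := by
  refine ⟨?_, ?_, ?_⟩
  · exact_mod_cast (by omega : (a + b + 1) / 2 + (a + b) / 2 = a + b)
  · have h : |(((a + b + 1) / 2 : ℕ) : ℤ) - ((a + b) / 2 : ℕ)| ≤ 1 := by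
      rw [abs_le]; omega
    exact_mod_cast h
  · have h : |(((a + b + 1) / 2 : ℕ) : ℤ) - ((a + b) / 2 : ℕ)| ≤ |(a : ℤ) - b| := by
      rcases abs_cases ((a : ℤ) - b) with h | h <;> rw [abs_le] <;> omega
    exact_mod_cast h

theorem Balances.neg {a b y z : ℝ} (h : Balances a b y z) : Balances (-a) (-b) (-y) (-z) := by
  refine ⟨by linarith [h.sum_eq], ?_, ?_⟩
  · rw [neg_sub_neg, abs_sub_comm]; exact h.abs_le_one
  · rw [neg_sub_neg, neg_sub_neg, abs_sub_comm z, abs_sub_comm b]; exact h.abs_le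

theorem Balances.symm {a b y z : ℝ} (h : Balances a b y z) : Balances b a y z :=
  ⟨by linarith [h.sum_eq], h.abs_le_one, abs_sub_comm a b ▸ h.abs_le⟩

theorem Balances.swap {a b y z : ℝ} (h : Balances a b y z) : Balances a b z y :=
  ⟨by linarith [h.sum_eq], abs_sub_comm y z ▸ h.abs_le_one, abs_sub_comm y z ▸ h.abs_le⟩

/-- With the sum fixed, the decrease is exactly ((a - b)² - (y - z)²)/2, and |y - z| is at most both
1 and |a - b|. -/
theorem Balances.sq_add_sq {a b y z : ℝ} (h : Balances a b y z) (μ : ℝ) :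
    (y - μ) ^ 2 + (z - μ) ^ 2 + max 0 ((a - b) ^ 2 - 1) / 2 ≤ (a - μ) ^ 2 + (b - μ) ^ 2 := by
  have h1 := sq_le_sq' (by linarith [neg_nonpos.2 (abs_nonneg (y - z)), abs_nonneg (y - z)])
    h.abs_le_one
  have h2 := sq_le_sq.2 h.abs_le
  rw [sq_abs] at h1
  have hs : (y - μ) ^ 2 + (z - μ) ^ 2 + ((a - b) ^ 2 - (y - z) ^ 2) / 2 =
      (a - μ) ^ 2 + (b - μ) ^ 2 := by
    have : y = a + b - z := by linarith [h.sum_eq]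
    subst this
    ring
  rcases max_cases 0 ((a - b) ^ 2 - 1) with h3 | h3 <;> rw [h3.1] <;> linarith

/-- Convexity of the squared positive part: balancing keeps the sum and does not increase the gap.
-/
theorem Balances.sqExcess_add_sqExcess {a b y z : ℝ} (h : Balances a b y z) (m : ℝ) :
    sqExcess m y + sqExcess m z ≤ sqExcess m a + sqExcess m b := by
  have key : ∀ {a b y z : ℝ}, a ≤ y → y ≤ z → z ≤ b → y + z = a + b →
      (max 0 y) ^ 2 + (max 0 z) ^ 2 ≤ (max 0 a) ^ 2 + (max 0 b) ^ 2 := by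
    intro a b y z h1 h2 h3 h4
    rcases le_total a 0 with ha | ha
    · rcases le_total y 0 with hy | hy
      · rw [max_eq_left ha, max_eq_left hy]
        gcongr
      · rw [max_eq_left ha, max_eq_right hy, max_eq_right (hy.trans h2),
          max_eq_right ((hy.trans h2).trans h3)]
        nlinarith
    · rw [max_eq_right ha, max_eq_right (ha.trans h1), max_eq_right ((ha.trans h1).trans h2),
        max_eq_right (((ha.trans h1).trans h2).trans h3)]
      nlinarith
  have main : ∀ {a b y z : ℝ}, Balances a b y z → a ≤ b → y ≤ z →
      sqExcess m y + sqExcess m z ≤ sqExcess m a + sqExcess m b := by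
    intro a b y z h hab hyz
    have h1 := h.abs_le
    have h2 := h.sum_eq
    rw [abs_of_nonpos (by linarith), abs_of_nonpos (by linarith)] at h1
    exact key (by linarith) (by linarith) (by linarith) (by linarith)
  rcases le_total a b with hab | hab <;> rcases le_total y z with hyz | hyz
  · exact main h hab hyz
  · linarith [main h.swap hab hyz]
  · linarith [main h.symm hab hyz]
  · linarith [main h.symm.swap hab hyz]

-- If b ≤ m, each new value is at most (a + b + 1)/2 ≤ (a + m + 1)/2, so its excess over m + 1 is at
-- most half that of a. The two new squares together are at most half the old one.
open scoped Classical in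
theorem Balances.sqExcess_add_half {a b y z : ℝ} (h : Balances a b y z) (m : ℝ) :
    sqExcess m y + sqExcess m z + ((if b ≤ m then sqExcess m a / 2 else 0) +
      if a ≤ m then sqExcess m b / 2 else 0) ≤ sqExcess m a + sqExcess m b := by
  have main : ∀ {a b : ℝ}, Balances a b y z → b ≤ m →
      sqExcess m y + sqExcess m z + sqExcess m a / 2 ≤ sqExcess m a := by
    intro a b h hb
    have h1 := _root_.abs_le.1 h.abs_le_one
    have h2 := h.sum_eq
    have h3 : ∀ x, x - (m + 1) ≤ (a - (m + 1)) / 2 →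
        sqExcess m x ≤ (max 0 (a - (m + 1)) / 2) ^ 2 := by
      intro x hx
      rw [sqExcess]
      refine pow_le_pow_left₀ (le_max_left _ _) (max_le (by positivity) ?_) 2
      linarith [le_max_right 0 (a - (m + 1))]
    have h4 := h3 y (by linarith)
    have h5 := h3 z (by linarith)
    simp only [sqExcess] at *
    nlinarith
  have h0 := h.sqExcess_add_sqExcess m
  split_ifs with h1 h2 h2
  · have := sqExcess_eq_zero (show b ≤ m + 1 by linarith)
    have := sqExcess_eq_zero (show a ≤ m + 1 by linarith)
    linarith
  · have := main h h1
    have := sqExcess_eq_zero (show b ≤ m + 1 by linarith)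
    linarith
  · have := main h.symm h2
    have := sqExcess_eq_zero (show a ≤ m + 1 by linarith)
    linarith
  · linarith

end Potential

/-! ### Decrease of the potential summed over all pairs -/

section Drop

variable {V : Type*} [Fintype V]

theorem sum_sub_eq_zero {x : V → ℝ} {μ : ℝ} (hx : ∑ v, x v = Fintype.card V * μ) :
    ∑ v, (x v - μ) = 0 := by
  rw [Finset.sum_sub_distrib, hx, Finset.sum_const, Finset.card_univ, nsmul_eq_mul, sub_self]

open scoped Classical in
/-- If the variance is at most `1` and no value lies strictly between `m` and `m + 1`, where the
mean is at most `m + 1 / 2`, then at least a fifth of the values are at most `m`. -/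
theorem card_le_five_mul_card_filter {x : V → ℝ} {μ m : ℝ}
    (hx : ∑ v, x v = Fintype.card V * μ) (hμ : μ ≤ m + 1 / 2)
    (hgap : ∀ v, x v ≤ m ∨ m + 1 ≤ x v) (hvar : ∑ v, (x v - μ) ^ 2 ≤ Fintype.card V) :
    (Fintype.card V : ℝ) ≤ 5 * (Finset.univ.filter fun v => x v ≤ m).card := by
  set S := Finset.univ.filter fun v => x v ≤ m
  set n : ℝ := ((Fintype.card V : ℕ) : ℝ) with hn
  set L : ℝ := (S.card : ℝ) with hL
  set δ : ℝ := m + 1 - μ with hδ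
  have hδ2 : 1 / 2 ≤ δ := by linarith
  have hLn : L ≤ n := by
    rw [hL, hn]
    exact_mod_cast S.card_le_univ
  have h0 := sum_sub_eq_zero hx
  have h1 : n * δ ≤ ∑ v ∈ S, (m + 1 - x v) := by
    have h2 : ∑ v, (m + 1 - x v) = n * δ := by
      rw [Finset.sum_sub_distrib, hx, Finset.sum_const, Finset.card_univ, nsmul_eq_mul]
      ring
    rw [← h2, ← Finset.sum_filter_add_sum_filter_not Finset.univ fun v => x v ≤ m]
    have h3 : ∑ v with ¬ x v ≤ m, (m + 1 - x v) ≤ 0 := by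
      refine Finset.sum_nonpos fun v hv => ?_
      have := (hgap v).resolve_left (Finset.mem_filter.1 hv).2
      linarith
    linarith
  have h2 : ∑ v ∈ S, (m + 1 - x v) ^ 2 ≤ n * (1 + δ ^ 2) := by
    calc _ ≤ ∑ v, (m + 1 - x v) ^ 2 :=
          Finset.sum_le_sum_of_subset_of_nonneg (Finset.subset_univ _) fun _ _ _ => sq_nonneg _
      _ = ∑ v, (δ ^ 2 + (-2 * δ) * (x v - μ) + (x v - μ) ^ 2) := by
          refine Finset.sum_congr rfl fun v _ => ?_
          rw [hδ]
          ring
      _ = n * δ ^ 2 + ∑ v, (x v - μ) ^ 2 := by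
          rw [Finset.sum_add_distrib, Finset.sum_add_distrib, ← Finset.mul_sum, h0,
            Finset.sum_const, Finset.card_univ, nsmul_eq_mul]
          ring
      _ ≤ n * (1 + δ ^ 2) := by linarith
  -- Cauchy–Schwarz on the low values gives L/n ≥ δ²/(1 + δ²), which is at least 1/5 because δ ≥
  -- 1/2.
  have h3 := sq_sum_le_card_mul_sum_sq (s := S) (f := fun v => m + 1 - x v)
  have hn0 : 0 ≤ n := Nat.cast_nonneg _
  have hL0 : 0 ≤ L := Nat.cast_nonneg _
  have h4 : (n * δ) ^ 2 ≤ L * (n * (1 + δ ^ 2)) :=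
    (pow_le_pow_left₀ (by positivity) h1 2).trans (h3.trans (by gcongr))
  rcases hn0.eq_or_lt with h5 | h5
  · rw [← h5]; positivity
  · have h6 : n * δ ^ 2 ≤ L * (1 + δ ^ 2) := by
      refine le_of_mul_le_mul_left ?_ h5
      linarith [h4]
    have h7 : (n - L) * (1 / 4) ≤ (n - L) * δ ^ 2 :=
      mul_le_mul_of_nonneg_left (by nlinarith) (by linarith)
    linarith

-- The double sum equals L/2 times the total squared excess, where L ≥ n/5 counts the values at most
-- m.
open scoped Classical in
theorem sum_sqExcess_le {x : V → ℝ} {μ m : ℝ}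
    (hx : ∑ v, x v = Fintype.card V * μ) (hμ : μ ≤ m + 1 / 2)
    (hgap : ∀ v, x v ≤ m ∨ m + 1 ≤ x v) (hvar : ∑ v, (x v - μ) ^ 2 ≤ Fintype.card V) :
    Fintype.card V / 10 * ∑ v, sqExcess m (x v) ≤
      ∑ v, ∑ u, ((if x u ≤ m then sqExcess m (x v) / 2 else 0) +
        if x v ≤ m then sqExcess m (x u) / 2 else 0) / 2 := by
  have h1 : ∑ v, ∑ u, (if x u ≤ m then sqExcess m (x v) / 2 else 0) =
      (Finset.univ.filter fun v => x v ≤ m).card * ∑ v, sqExcess m (x v) / 2 := by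
    simp only [← Finset.sum_filter, Finset.sum_const, nsmul_eq_mul, ← Finset.mul_sum]
  have h2 : ∑ v, ∑ u, (if x v ≤ m then sqExcess m (x u) / 2 else 0) =
      (Finset.univ.filter fun v => x v ≤ m).card * ∑ v, sqExcess m (x v) / 2 := by
    rw [Finset.sum_comm, h1]
  simp only [← Finset.sum_div, Finset.sum_add_distrib] at h1 h2 ⊢
  rw [h1, h2]
  have h3 := card_le_five_mul_card_filter hx hμ hgap hvar
  have h4 : 0 ≤ ∑ v, sqExcess m (x v) := Finset.sum_nonneg fun v _ => sqExcess_nonneg _ _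
  nlinarith

theorem sum_sum_sub_sq {x : V → ℝ} {μ : ℝ} (hx : ∑ v, x v = Fintype.card V * μ) :
    ∑ v, ∑ u, (x v - x u) ^ 2 = 2 * Fintype.card V * ∑ v, (x v - μ) ^ 2 := by
  have h0 := sum_sub_eq_zero hx
  have h1 : ∀ v, ∑ u, (x v - x u) ^ 2 =
      Fintype.card V * (x v - μ) ^ 2 + ∑ u, (x u - μ) ^ 2 := by
    intro v
    have h2 : ∀ u, (x v - x u) ^ 2 =
        (x v - μ) ^ 2 + (-2 * (x v - μ)) * (x u - μ) + (x u - μ) ^ 2 := fun u => by ring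
    simp only [h2]
    rw [Finset.sum_add_distrib, Finset.sum_add_distrib, ← Finset.mul_sum, h0,
      Finset.sum_const, Finset.card_univ, nsmul_eq_mul]
    ring
  simp only [h1]
  rw [Finset.sum_add_distrib, ← Finset.mul_sum, Finset.sum_const, Finset.card_univ, nsmul_eq_mul]
  ring

open scoped Classical in
/-- The potential of a load vector `x` with mean `μ` near `m`: the sum of the squared distances to
the interval `[m - 1, m + 1]`, together with the sum of the squared deviations from `μ` as long as
the latter exceeds the number of vertices. -/
noncomputable def potential (μ m : ℝ) (x : V → ℝ) : ℝ :=
  if ∑ v, (x v - μ) ^ 2 ≤ Fintype.card V then ∑ v, sqDist m (x v)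
  else ∑ v, (x v - μ) ^ 2 + ∑ v, sqDist m (x v)

theorem sum_sqDist_nonneg (m : ℝ) (x : V → ℝ) : 0 ≤ ∑ v, sqDist m (x v) :=
  Finset.sum_nonneg fun _ _ => sqDist_nonneg _ _

theorem sum_sq_sub_nonneg (μ : ℝ) (x : V → ℝ) : 0 ≤ ∑ v, (x v - μ) ^ 2 :=
  Finset.sum_nonneg fun _ _ => sq_nonneg _

theorem sum_sqDist_le_potential (μ m : ℝ) (x : V → ℝ) :
    ∑ v, sqDist m (x v) ≤ potential μ m x := by
  unfold potential
  split_ifs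
  · exact le_rfl
  · linarith [sum_sq_sub_nonneg μ x]

theorem potential_nonneg (μ m : ℝ) (x : V → ℝ) : 0 ≤ potential μ m x :=
  (sum_sqDist_nonneg m x).trans (sum_sqDist_le_potential μ m x)

theorem potential_le (μ m : ℝ) (x : V → ℝ) :
    potential μ m x ≤ ∑ v, (x v - μ) ^ 2 + ∑ v, sqDist m (x v) := by
  unfold potential
  split_ifs
  · linarith [sum_sq_sub_nonneg μ x]
  · exact le_rfl

theorem potential_le_two_mul {μ m : ℝ} (h : |μ - m| ≤ 1 / 2) (x : V → ℝ) :
    potential μ m x ≤ 2 * ∑ v, (x v - μ) ^ 2 := by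
  have h2 : ∑ v, sqDist m (x v) ≤ ∑ v, (x v - μ) ^ 2 :=
    Finset.sum_le_sum fun v _ => sqDist_le_sq (h.trans (by norm_num))
  linarith [potential_le μ m x]

open scoped Classical in
/-- Balancing along a matching decreases the potential by the sum of suitable terms over the
matched pairs, and the sum of these terms over all pairs is large. -/
theorem exists_drop {μ : ℝ} {m : ℤ} (h : |μ - m| ≤ 1 / 2) {γ : V → ℕ}
    (hγ : ∑ v, (γ v : ℝ) = Fintype.card V * μ) :
    ∃ d : V → V → ℝ, (∀ v u, 0 ≤ d v u) ∧ (∀ v, d v v = 0) ∧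
      Fintype.card V / 10 * potential μ m (fun v => (γ v : ℝ)) ≤ ∑ v, ∑ u, d v u ∧
      ∀ (G : SimpleGraph V) (M : Finset (Sym2 V)), IsMatching G M → ∀ up,
        potential μ m (fun v => (balance γ M up v : ℝ)) +
          ∑ v, ∑ u, (if s(v, u) ∈ M then d v u else 0) ≤ potential μ m (fun v => (γ v : ℝ)) := by
  have hdist : ∀ {a b y z : ℝ}, Balances a b y z →
      sqDist m y + sqDist m z ≤ sqDist m a + sqDist m b := by
    intro a b y z hb
    have h1 := hb.sqExcess_add_sqExcess m
    have h2 := hb.neg.sqExcess_add_sqExcess (-m)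
    simp only [sqDist]
    linarith
  have hn : (0 : ℝ) ≤ Fintype.card V := Nat.cast_nonneg _
  by_cases hvar : ∑ v, ((γ v : ℝ) - μ) ^ 2 ≤ Fintype.card V
  · set D : ℝ → ℝ → ℝ → ℝ := fun m a b =>
      (if b ≤ m then sqExcess m a / 2 else 0) + if a ≤ m then sqExcess m b / 2 else 0 with hD
    have hD0 : ∀ m a b, 0 ≤ D m a b := by
      intro m a b
      have := sqExcess_nonneg m a
      have := sqExcess_nonneg m b
      simp only [hD]
      split_ifs <;> linarith
    have hDself : ∀ m a, D m a a = 0 := by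
      intro m a
      simp only [hD]
      split_ifs with h
      · rw [sqExcess_eq_zero (by linarith)]
        norm_num
      · norm_num
    have hpot : potential μ m (fun v => (γ v : ℝ)) = ∑ v, sqDist m (γ v) := if_pos hvar
    refine ⟨fun v u => (D m (γ v) (γ u) + D (-m) (-(γ v)) (-(γ u))) / 2, fun v u => ?_,
      fun v => ?_, ?_, fun G M hM up => ?_⟩
    · have := hD0 m (γ v) (γ u)
      have := hD0 (-m) (-(γ v)) (-(γ u))
      positivity
    · simp only [hDself]
      norm_num
    · rw [abs_le] at h
      have hgap : ∀ v, ((γ v : ℝ) ≤ m ∨ (m : ℝ) + 1 ≤ γ v) ∧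
          (-(γ v : ℝ) ≤ -m ∨ -(m : ℝ) + 1 ≤ -γ v) := by
        intro v
        have h1 : ((γ v : ℤ) ≤ m ∨ m + 1 ≤ (γ v : ℤ)) ∧
          (-(γ v : ℤ) ≤ -m ∨ -m + 1 ≤ -(γ v : ℤ)) := by omega
        exact_mod_cast h1
      have h1 := sum_sqExcess_le hγ (by linarith) (fun v => (hgap v).1) hvar
      -- Reflection treats the deficit below m - 1 as an excess.
      have h2 := sum_sqExcess_le (x := fun v => -(γ v : ℝ)) (μ := -μ) (m := -m)
        (by rw [Finset.sum_neg_distrib, hγ]; ring) (by linarith) (fun v => (hgap v).2)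
        (by simpa only [neg_sub_neg, sub_sq_comm] using hvar)
      rw [hpot]
      simp only [sqDist, add_div, Finset.sum_add_distrib, mul_add, hD] at h1 h2 ⊢
      linarith
    · have h1 := hM.sum_balance_add_le (sqDist m) (fun a b => D m a b + D (-m) (-a) (-b)) γ
        (fun a b => by
          have h1 := (balances_natCast a b).sqExcess_add_half m
          have h2 := (balances_natCast a b).neg.sqExcess_add_half (-m)
          simp only [sqDist, hD]
          linarith) up
      have h2 := hM.sum_balance_add_le (fun x => (x - μ) ^ 2) (fun _ _ => 0) γ
        (fun a b => by
          have h1 := (balances_natCast a b).sq_add_sq μ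
          have := le_max_left 0 (((a : ℝ) - b) ^ 2 - 1)
          linarith) up
      simp only [zero_div, ite_self, Finset.sum_const_zero, add_zero] at h2
      -- The squared deviations do not increase, so the small regime is never left.
      rw [hpot, potential, if_pos (h2.trans hvar)]
      exact h1
  · have hpot : potential μ m (fun v => (γ v : ℝ)) =
        ∑ v, ((γ v : ℝ) - μ) ^ 2 + ∑ v, sqDist m (γ v) := if_neg hvar
    refine ⟨fun v u => (max 0 (((γ v : ℝ) - γ u) ^ 2 - 1) / 2) / 2, fun v u => ?_,
      fun v => ?_, ?_, fun G M hM up => ?_⟩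
    · have := le_max_left 0 (((γ v : ℝ) - γ u) ^ 2 - 1)
      positivity
    · norm_num
    · have h1 := potential_le_two_mul h (fun v => (γ v : ℝ))
      have h2 : ∑ v, ∑ u, (((γ v : ℝ) - γ u) ^ 2 / 4 - 1 / 4) ≤
          ∑ v, ∑ u, (max 0 (((γ v : ℝ) - γ u) ^ 2 - 1) / 2) / 2 := by
        refine Finset.sum_le_sum fun v _ => Finset.sum_le_sum fun u _ => ?_
        linarith [le_max_right 0 (((γ v : ℝ) - γ u) ^ 2 - 1)]
      simp only [Finset.sum_sub_distrib, Finset.sum_const, Finset.card_univ, nsmul_eq_mul] at h2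
      have h3 : (∑ v, ∑ u, ((γ v : ℝ) - γ u) ^ 2 / 4 : ℝ) =
          2 * (Fintype.card V : ℝ) * (∑ v, ((γ v : ℝ) - μ) ^ 2) / 4 := by
        simp only [← Finset.sum_div, sum_sum_sub_sq hγ]
      rw [h3] at h2
      push Not at hvar
      refine le_trans ?_ h2
      -- With S the sum of squared deviations, the total is at least nS/2 - n²/4 ≥ nS/4, because S >
      -- n. This is at least n/8 times the potential, which is at most 2S.
      nlinarith [mul_le_mul_of_nonneg_left h1 hn, mul_le_mul_of_nonneg_left hvar.le hn]
    · have h1 := hM.sum_balance_add_le (fun x => (x - μ) ^ 2 + sqDist m x)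
        (fun a b => max 0 ((a - b) ^ 2 - 1) / 2) γ
        (fun a b => by
          have h1 := (balances_natCast a b).sq_add_sq μ
          have h2 := hdist (balances_natCast a b)
          linarith) up
      rw [Finset.sum_add_distrib, Finset.sum_add_distrib] at h1
      rw [hpot]
      -- Crossing into the small regime only removes a nonnegative term from the new potential.
      exact le_trans (by gcongr; exact potential_le _ _ _) h1

end Drop

/-! ### Geometric decay of the expected potential -/

section Decay

variable {V : Type*} [Fintype V]

open scoped Classical in
/-- The potential of a configuration whose average load is `μ`. -/
noncomputable def loadPotential (μ : ℝ) (m : ℤ) (γ : V → ℕ) : ENNReal :=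
  -- The value ⊤ at other averages makes the contraction trivially true there, so it holds for every
  -- load and conservation of the average need not be carried along the execution.
  if average γ = μ then ENNReal.ofReal (potential μ m fun v => (γ v : ℝ)) else ⊤

theorem expect_nextLoad_le {μ : ℝ} {m : ℤ} {γ : V → ℕ} {G : SimpleGraph V}
    {M : Finset (Sym2 V)} (hM : IsMatching G M) (hγ : average γ = μ) {c : ℝ} (hc : 0 ≤ c)
    (h : ∀ up, potential μ m (fun v => (balance γ M up v : ℝ)) + c ≤
      potential μ m (fun v => (γ v : ℝ))) :
    expect (nextLoad γ M) (loadPotential μ m) + ENNReal.ofReal c ≤ loadPotential μ m γ := by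
  classical
  rw [nextLoad, expect_map, ← expect_const
    (PMF.uniformOfFintype ((e : Sym2 V) → {v : V // v ∈ e})) (ENNReal.ofReal c), ← expect_add]
  refine le_trans (expect_mono fun up _ => ?_) (expect_const
    (PMF.uniformOfFintype ((e : Sym2 V) → {v : V // v ∈ e})) _).le
  rw [loadPotential, loadPotential, if_pos hγ, if_pos ((hM.average_balance γ up).trans hγ),
    ← ENNReal.ofReal_add (potential_nonneg _ _ _) hc]
  exact ENNReal.ofReal_le_ofReal (h up)

theorem sum_eq_card_mul_average [Nonempty V] (γ : V → ℕ) :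
    ∑ v, (γ v : ℝ) = Fintype.card V * average γ := by
  rw [average, mul_div_cancel₀]
  exact_mod_cast Fintype.card_ne_zero

/-- If every pair of vertices is matched with probability at least `β`, then the expected
potential decreases by the factor `1 - β n / 10`. -/
theorem expect_loadPotential_le [Nonempty V] {μ : ℝ} {m : ℤ} (hm : |μ - m| ≤ 1 / 2)
    (P : PMF (SimpleGraph V)) (D : SimpleGraph V → PMF (Finset (Sym2 V)))
    (hD : ∀ G, ∀ M ∈ (D G).support, IsMatching G M) {β : ℝ} (hβ : 0 ≤ β)
    (hβ1 : β * Fintype.card V / 10 < 1)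
    (hpair : ∀ u v, u ≠ v → ENNReal.ofReal β ≤
      expect P fun G => (D G).toOuterMeasure {M | s(u, v) ∈ M}) (γ : V → ℕ) :
    (expect P fun G => expect (D G) fun M => expect (nextLoad γ M) (loadPotential μ m)) ≤
      ENNReal.ofReal (1 - β * Fintype.card V / 10) * loadPotential μ m γ := by
  classical
  by_cases hγ : average γ = μ
  swap
  · rw [loadPotential, if_neg hγ, ENNReal.mul_top]
    · exact le_top
    · simpa using hβ1
  obtain ⟨d, hd0, hdself, hdsum, hd⟩ :=
    exists_drop hm (γ := γ) (by rw [sum_eq_card_mul_average, hγ])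
  set X := expect P fun G => expect (D G) fun M => expect (nextLoad γ M) (loadPotential μ m)
    with hX
  set w := potential μ m fun v => (γ v : ℝ) with hw
  have hw0 : 0 ≤ w := potential_nonneg _ _ _
  have hWγ : loadPotential μ m γ = ENNReal.ofReal w := if_pos hγ
  have h1 : X + ∑ v, ∑ u, ENNReal.ofReal (d v u) *
      (expect P fun G => (D G).toOuterMeasure {M | s(v, u) ∈ M}) ≤ ENNReal.ofReal w := by
    calc _ = expect P fun G => expect (D G) fun M => (expect (nextLoad γ M) (loadPotential μ m) +
          ∑ v, ∑ u, if M ∈ {M : Finset (Sym2 V) | s(v, u) ∈ M} then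
            ENNReal.ofReal (d v u) else 0) := by
          simp only [expect_add, expect_sum, expect_indicator, expect_const_mul, hX]
      _ ≤ expect P fun G => expect (D G) fun M => ENNReal.ofReal w := by
          refine expect_mono fun G _ => expect_mono fun M hM => ?_
          have hnn : ∀ v u, 0 ≤ if s(v, u) ∈ M then d v u else 0 := by
            intro v u
            split_ifs
            · exact hd0 v u
            · exact le_rfl
          have h2 := expect_nextLoad_le (hD G M hM) hγ
            (Finset.sum_nonneg fun v _ => Finset.sum_nonneg fun u _ => hnn v u)
            (hd G M (hD G M hM))
          rw [hWγ, ENNReal.ofReal_sum_of_nonneg fun v _ =>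
            Finset.sum_nonneg fun u _ => hnn v u] at h2
          refine le_trans (le_of_eq ?_) h2
          congr 1
          refine Finset.sum_congr rfl fun v _ => ?_
          rw [ENNReal.ofReal_sum_of_nonneg fun u _ => hnn v u]
          refine Finset.sum_congr rfl fun u _ => ?_
          by_cases hvu : s(v, u) ∈ M <;> simp [hvu]
      _ = ENNReal.ofReal w := by simp only [expect_const]
  have h2 : ENNReal.ofReal (β * Fintype.card V / 10 * w) ≤ ∑ v, ∑ u, ENNReal.ofReal (d v u) *
      (expect P fun G => (D G).toOuterMeasure {M | s(v, u) ∈ M}) := by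
    calc _ ≤ ENNReal.ofReal (∑ v, ∑ u, d v u * β) := by
          apply ENNReal.ofReal_le_ofReal
          simp only [← Finset.sum_mul]
          have := mul_le_mul_of_nonneg_right hdsum hβ
          linarith
      _ = ∑ v, ∑ u, ENNReal.ofReal (d v u) * ENNReal.ofReal β := by
          rw [ENNReal.ofReal_sum_of_nonneg fun v _ =>
            Finset.sum_nonneg fun u _ => mul_nonneg (hd0 v u) hβ]
          refine Finset.sum_congr rfl fun v _ => ?_
          rw [ENNReal.ofReal_sum_of_nonneg fun u _ => mul_nonneg (hd0 v u) hβ]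
          exact Finset.sum_congr rfl fun u _ => ENNReal.ofReal_mul (hd0 v u)
      _ ≤ _ := by
          refine Finset.sum_le_sum fun v _ => Finset.sum_le_sum fun u _ => ?_
          by_cases hvu : v = u
          · simp [hvu, hdself]
          · gcongr
            exact hpair v u hvu
  have h3 : X + ENNReal.ofReal (β * Fintype.card V / 10 * w) ≤ ENNReal.ofReal w :=
    le_trans (by gcongr) h1
  rw [hWγ, ← ENNReal.ofReal_mul (by linarith), sub_mul, one_mul,
    ENNReal.ofReal_sub _ (by positivity)]
  exact ENNReal.le_sub_of_add_le_right ENNReal.ofReal_ne_top h3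

theorem abs_sub_nearest_le (x : ℝ) : |x - nearest x| ≤ 1 / 2 := by
  have h1 := Int.le_ceil (x - 1 / 2)
  have h2 := Int.ceil_lt_add_one (x - 1 / 2)
  rw [nearest, abs_le]
  constructor <;> linarith

theorem one_le_loadPotential {μ : ℝ} {m : ℤ} {γ : V → ℕ} (h : ¬ IsBalanced m γ) :
    1 ≤ loadPotential μ m γ := by
  unfold loadPotential
  split_ifs
  · rw [IsBalanced, not_forall] at h
    obtain ⟨v, hv⟩ := h
    rw [ENNReal.one_le_ofReal]
    refine le_trans ?_ (sum_sqDist_le_potential μ m _)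
    refine le_trans ?_ (Finset.single_le_sum (fun u _ => sqDist_nonneg _ _) (Finset.mem_univ v))
    exact_mod_cast one_le_sqDist hv
  · exact le_top

theorem abs_sub_average_le [Nonempty V] (γ : V → ℕ) (v : V) :
    |(γ v : ℝ) - average γ| ≤ discrepancy γ := by
  have h1 : ∀ u, Finset.univ.inf' Finset.univ_nonempty γ ≤ γ u := fun u =>
    Finset.inf'_le γ (Finset.mem_univ u)
  have h2 : ∀ u, γ u ≤ Finset.univ.sup' Finset.univ_nonempty γ := fun u =>
    Finset.le_sup' γ (Finset.mem_univ u)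
  have h3 : ∀ u w, (γ u : ℝ) - γ w ≤ discrepancy γ := by
    intro u w
    have h : γ u ≤ discrepancy γ + γ w := by
      have := h1 w
      have := h2 u
      unfold discrepancy
      omega
    have : (γ u : ℝ) ≤ discrepancy γ + γ w := by exact_mod_cast h
    linarith
  have hn : (0 : ℝ) < Fintype.card V := by exact_mod_cast Fintype.card_pos
  have h4 := sum_eq_card_mul_average γ
  have h5 : ∑ u, ((γ v : ℝ) - γ u) = Fintype.card V * (γ v - average γ) := by
    rw [Finset.sum_sub_distrib, h4, Finset.sum_const, Finset.card_univ, nsmul_eq_mul]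
    ring
  have h6 : ∑ u, ((γ v : ℝ) - γ u) ≤ Fintype.card V * discrepancy γ := by
    rw [← nsmul_eq_mul, ← Finset.card_univ]
    exact Finset.sum_le_card_nsmul _ _ _ fun u _ => h3 v u
  have h7 : Fintype.card V * -(discrepancy γ : ℝ) ≤ ∑ u, ((γ v : ℝ) - γ u) := by
    rw [← nsmul_eq_mul, ← Finset.card_univ]
    exact Finset.card_nsmul_le_sum _ _ _ fun u _ => by linarith [h3 u v]
  rw [h5] at h6 h7
  exact abs_le.2 ⟨le_of_mul_le_mul_left h7 hn, le_of_mul_le_mul_left h6 hn⟩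

theorem loadPotential_le [Nonempty V] (γ : V → ℕ) :
    loadPotential (average γ) (nearest (average γ)) γ ≤
      ENNReal.ofReal (2 * Fintype.card V * (discrepancy γ : ℝ) ^ 2) := by
  rw [loadPotential, if_pos rfl]
  refine ENNReal.ofReal_le_ofReal ((potential_le_two_mul (abs_sub_nearest_le _) _).trans ?_)
  rw [mul_assoc]
  refine mul_le_mul_of_nonneg_left ?_ two_pos.le
  rw [← nsmul_eq_mul, ← Finset.card_univ]
  exact Finset.sum_le_card_nsmul _ _ _ fun v _ => sq_le_sq.2 <| by
    rw [Nat.abs_cast]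
    exact abs_sub_average_le γ v

/-- The probability that the configuration is not balanced decays geometrically. -/
theorem executionLaw_not_isBalanced_le [Nonempty V] (p q : unitInterval)
    (A : MatchingAlgorithm V) (G₀ : SimpleGraph V) (Γ₀ : V → ℕ) {F : ℝ} (hF : 0 ≤ F)
    (hA : A.IsFair F) {β : ℝ}
    (hβ : β = min (p : ℝ) (1 - q) * (F / (1 + 2 * Fintype.card V * max (p : ℝ) (1 - q))))
    (hβ1 : β * Fintype.card V / 10 < 1) (t : ℕ) :
    executionLaw p q A G₀ Γ₀ {ω | ¬ IsBalanced (nearest (average Γ₀)) (ω (t + 1)).load} ≤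
      ENNReal.ofReal ((1 - β * Fintype.card V / 10) ^ t *
        (2 * Fintype.card V * (discrepancy Γ₀ : ℝ) ^ 2)) := by
  set μ := average Γ₀
  set m := nearest μ
  have hm : |μ - m| ≤ 1 / 2 := abs_sub_nearest_le μ
  have hβ0 : 0 ≤ β := by
    have := p.2.1
    have := q.2.2
    have h1 : 0 ≤ min (p : ℝ) (1 - q) := le_min (by linarith) (by linarith)
    have h2 : 0 ≤ max (p : ℝ) (1 - q) := le_max_of_le_left (by linarith)
    rw [hβ]
    positivity
  have h := lintegral_load_le p q A G₀ Γ₀ (loadPotential μ m)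
    (ENNReal.ofReal (1 - β * Fintype.card V / 10))
    (fun γ G M hM => by
      by_cases hγ : average γ = μ
      · obtain ⟨d, hd0, -, -, hd⟩ :=
          exists_drop hm (γ := γ) (by rw [sum_eq_card_mul_average, hγ])
        refine le_trans le_self_add (expect_nextLoad_le (c := 0) hM hγ le_rfl fun up => ?_)
        refine le_trans ?_ (hd G M hM up)
        gcongr
        refine Finset.sum_nonneg fun v _ => Finset.sum_nonneg fun u _ => ?_
        split_ifs
        · exact hd0 v u
        · exact le_rfl
      · rw [loadPotential, if_neg hγ]
        exact le_top)
    (fun t past γ H => expect_loadPotential_le hm _ _ (A.isMatching _ _ _) hβ0 hβ1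
      (fun u v huv => hβ ▸ hA.le_expect_nextGraph hF _ _ _ huv) γ) t
  calc _ ≤ ∫⁻ ω, loadPotential μ m (ω (t + 1)).load ∂executionLaw p q A G₀ Γ₀ := by
        have hmeas : Measurable fun ω : ℕ → Snapshot V =>
            loadPotential μ m (ω (t + 1)).load :=
          (measurable_from_top (f := fun s : Snapshot V => loadPotential μ m s.load)).comp
            (measurable_pi_apply (t + 1))
        -- Markov's inequality at level 1.
        refine le_trans (measure_mono fun ω hω => ?_)
          ((one_mul _).symm.le.trans (mul_meas_ge_le_lintegral hmeas 1))
        exact one_le_loadPotential hω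
    _ ≤ _ := h
    _ ≤ _ := by
        rw [ENNReal.ofReal_mul (pow_nonneg (by linarith) t), ENNReal.ofReal_pow (by linarith)]
        gcongr
        exact loadPotential_le Γ₀

end Decay

/-! ### Numerical estimates for the rate and the number of steps -/

/-- The squared factor in `cStar` is at most 1; the argument yields the larger constant on the
right. -/
theorem cStar_le {θ : ℝ} (hθ : 0 < θ) : cStar θ ≤ θ / (1 + 2 * θ) := by
  have h1 : Real.exp (-θ / 3) ≤ 1 := Real.exp_le_one_iff.2 (by linarith)
  have h2 := Real.exp_pos (-θ / 3)
  have h3 : θ / (1 + 2 * θ) = 1 / (2 + 1 / θ) := by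
    field_simp
    ring
  rw [cStar, h3]
  gcongr
  nlinarith

theorem cStar_pos {θ : ℝ} (hθ : 0 < θ) : 0 < cStar θ := by
  have h1 : Real.exp (-θ / 3) < 1 := by
    rw [← Real.exp_zero]
    exact Real.exp_lt_exp.2 (by linarith)
  have : 0 < 1 - Real.exp (-θ / 3) := by linarith
  unfold cStar
  positivity

/-- The rate of the decay is at least a constant times `F / r`. -/
theorem cStar_mul_div_le {θ p q n F r : ℝ} (hθ : 0 < θ) (hp : 0 < p) (hq : q < 1) (hn : 0 < n)
    (hpq : θ / n ≤ max p (1 - q)) (hF : 0 ≤ F) (hr : r = max (p / (1 - q)) ((1 - q) / p)) :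
    cStar θ * F / r ≤ min p (1 - q) * (F / (1 + 2 * n * max p (1 - q))) * n := by
  have hq' : 0 < 1 - q := by linarith
  have hrQ : r = max p (1 - q) / min p (1 - q) := by
    rw [hr]
    rcases le_total p (1 - q) with h | h
    · rw [max_eq_right h, min_eq_left h, max_eq_right]
      rw [div_le_div_iff₀ hq' hp]
      nlinarith
    · rw [max_eq_left h, min_eq_right h, max_eq_left]
      rw [div_le_div_iff₀ hp hq']
      nlinarith
  set P := max p (1 - q)
  set Q := min p (1 - q)
  have hP : 0 < P := lt_max_of_lt_left hp
  have hQ : 0 < Q := lt_min hp hq'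
  have hθP : θ ≤ n * P := by
    rw [div_le_iff₀ hn] at hpq
    linarith
  -- The function x/(1 + 2x) is increasing, and nP ≥ θ.
  have h1 : cStar θ ≤ n * P / (1 + 2 * (n * P)) := by
    refine (cStar_le hθ).trans ?_
    rw [div_le_div_iff₀ (by positivity) (by positivity)]
    nlinarith
  calc cStar θ * F / r ≤ n * P / (1 + 2 * (n * P)) * F / r := by
        rw [hrQ]
        gcongr
    _ = _ := by
        rw [hrQ]
        field_simp

/-- After about `91 X / a` steps with decay rate `a / 10`, where `X = log (Δ n / ε)`, the potential
is at most `ε`. -/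
theorem pow_mul_le {a κ X n Δ ε : ℝ} (ha : 0 < a) (ha1 : a ≤ 1) (hκ : a / 10 ≤ κ) (hκ1 : κ < 1)
    (hn : 2 ≤ n) (hΔ : 1 ≤ Δ) (hε : 0 < ε) (hε1 : ε < 1 / 4) (hX : X = Real.log (Δ * n / ε))
    {t : ℕ} (ht : 91 * X / a ≤ t + 2) :
    (1 - κ) ^ t * (2 * n * Δ ^ 2) ≤ ε := by
  have hpos : 0 < Δ * n / ε := by positivity
  have hexp : Real.exp X = Δ * n / ε := by rw [hX, Real.exp_log hpos]
  have hX1 : 1 ≤ X := by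
    have h8 : 8 ≤ Δ * n / ε := by
      rw [le_div_iff₀ hε]
      nlinarith
    rw [hX, Real.le_log_iff_exp_le hpos]
    linarith [Real.exp_one_lt_d9]
  have h1 : (1 - κ) ^ t ≤ Real.exp (-(2 * X)) := by
    calc (1 - κ) ^ t ≤ Real.exp (-κ) ^ t :=
          pow_le_pow_left₀ (by linarith) (Real.one_sub_le_exp_neg κ) t
      _ = Real.exp (t * -κ) := (Real.exp_nat_mul _ _).symm
      _ ≤ Real.exp (-(2 * X)) := by
          rw [Real.exp_le_exp]
          rw [div_le_iff₀ ha] at ht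
          -- Here tκ ≥ (91X - 2a)/10 ≥ 9.1X - 0.2 ≥ 2X, since a ≤ 1 ≤ X. The exponent 2X is chosen
          -- to cancel the square of Δ in the initial potential.
          have h2 : (t : ℝ) * (a / 10) ≤ t * κ :=
            mul_le_mul_of_nonneg_left hκ (Nat.cast_nonneg t)
          linarith
  have h2 : Real.exp (-(2 * X)) = (ε / (Δ * n)) ^ 2 := by
    rw [Real.exp_neg, two_mul, Real.exp_add, hexp, ← sq, ← inv_pow, inv_div]
  calc (1 - κ) ^ t * (2 * n * Δ ^ 2) ≤ (ε / (Δ * n)) ^ 2 * (2 * n * Δ ^ 2) := by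
        rw [← h2]
        gcongr
    _ = ε * (ε * (2 / n)) := by
        field_simp
    _ ≤ ε * 1 := by
        have : 2 / n ≤ 1 := (div_le_one (by linarith)).2 hn
        gcongr
        nlinarith
    _ = ε := mul_one ε

theorem isBalanced_of_discrepancy_eq_zero {V : Type*} [Fintype V] [Nonempty V] {γ : V → ℕ}
    (h : discrepancy γ = 0) : IsBalanced (nearest (average γ)) γ := by
  intro v
  have h1 := abs_sub_average_le γ v
  rw [h, Nat.cast_zero] at h1
  have h2 : (γ v : ℝ) = average γ := sub_eq_zero.1 (abs_nonpos_iff.1 h1)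
  right; left
  rw [nearest, ← h2, eq_comm, Int.ceil_eq_iff]
  push_cast
  constructor <;> linarith

theorem balancingTime_le {V : Type*} [Fintype V] {ω : ℕ → Snapshot V} {t : ℕ} {T : ℝ}
    (h : IsBalanced (nearest (average (ω 0).load)) (ω t).load) (ht : (t : ℝ) ≤ T) :
    (balancingTime ω : ENNReal) ≤ ENNReal.ofReal T := by
  have h1 : balancingTime ω ≤ (t : ℕ∞) := sInf_le ⟨t, rfl, h⟩
  calc (balancingTime ω : ENNReal) ≤ ((t : ℕ∞) : ENNReal) := ENat.toENNReal_le.2 h1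
    _ = ENNReal.ofReal t := by simp
    _ ≤ ENNReal.ofReal T := ENNReal.ofReal_le_ofReal ht

end LoadBalancing

open LoadBalancing in
theorem mainTheorem1 {V : Type*} [Fintype V] [Nonempty V]
    (θ : ℝ) (hθ : 0 < θ)
    (p q : unitInterval) (hp : 0 < p) (hq : q < 1)
    (hpq : θ / Fintype.card V ≤ max (p : ℝ) (1 - q))
    (G₀ : SimpleGraph V) (Γ₀ : V → ℕ)
    (A : LoadBalancing.MatchingAlgorithm V)
    (F : ℝ) (hF₀ : 0 < F) (hF₁ : F ≤ 1) (hA : A.IsFair F)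
    (ε : ℝ) (hε₀ : 0 < ε) (hε₁ : ε < 1 / 4)
    (n Δ r c : ℝ) (hn : n = Fintype.card V) (hΔ : Δ = LoadBalancing.discrepancy Γ₀)
    (hr : r = max ((p : ℝ) / (1 - q)) ((1 - q) / p)) (hc : c = 91 / LoadBalancing.cStar θ) :
    ENNReal.ofReal (1 - ε) ≤ LoadBalancing.executionLaw p q A G₀ Γ₀
      {ω | (LoadBalancing.balancingTime ω : ENNReal) ≤
        ENNReal.ofReal (c * r * Real.log (Δ * n / ε) / F)} := by
  have hae := ae_load_zero p q A G₀ Γ₀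
  rcases Nat.eq_zero_or_pos (discrepancy Γ₀) with h0 | h0
  · have hall : ∀ᵐ ω ∂executionLaw p q A G₀ Γ₀, ω ∈ {ω : ℕ → Snapshot V |
        (balancingTime ω : ENNReal) ≤ ENNReal.ofReal (c * r * Real.log (Δ * n / ε) / F)} := by
      filter_upwards [hae] with ω hω
      -- Since `Real.log 0 = 0`, the time bound is 0 in this case.
      refine balancingTime_le (t := 0) ?_ (by simp [hΔ, h0])
      rw [hω]
      exact isBalanced_of_discrepancy_eq_zero h0
    calc ENNReal.ofReal (1 - ε) ≤ 1 := ENNReal.ofReal_le_one.2 (by linarith)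
      _ = executionLaw p q A G₀ Γ₀ Set.univ := measure_univ.symm
      _ ≤ _ := measure_mono_ae (hall.mono fun ω h _ => h)
  have hp' : (0 : ℝ) < p := hp
  have hq' : (q : ℝ) < 1 := hq
  have hq'' : (0 : ℝ) < 1 - q := by linarith
  have hΔ1 : 1 ≤ Δ := by
    rw [hΔ]
    exact_mod_cast h0
  have hn2 : 2 ≤ n := by
    rw [hn]
    by_contra hlt
    have hcard : Fintype.card V ≤ 1 := by
      by_contra h
      exact hlt (by exact_mod_cast (by omega : 2 ≤ Fintype.card V))
    have := Fintype.card_le_one_iff_subsingleton.1 hcard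
    obtain ⟨v⟩ := ‹Nonempty V›
    have hconst : Γ₀ = fun _ => Γ₀ v := funext fun u => congrArg Γ₀ (Subsingleton.elim u v)
    rw [hconst, discrepancy, Finset.sup'_const, Finset.inf'_const] at h0
    omega
  set P : ℝ := max (p : ℝ) (1 - q) with hP
  set Q : ℝ := min (p : ℝ) (1 - q) with hQ
  have hP0 : 0 < P := lt_max_of_lt_left hp'
  have hQ0 : 0 < Q := lt_min hp' hq''
  have hQP : Q ≤ P := min_le_max
  have hr1 : 0 < r := by
    rw [hr]
    exact lt_max_of_lt_left (by positivity)
  set β : ℝ := Q * (F / (1 + 2 * Fintype.card V * P)) with hβ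
  set a : ℝ := cStar θ * F / r with ha
  have ha0 : 0 < a := by
    have := cStar_pos hθ
    positivity
  have haβ : a ≤ β * n := by
    rw [hβ, ← hn]
    exact cStar_mul_div_le hθ hp' hq' (by linarith) (hn ▸ hpq) hF₀.le hr
  have hβn : β * n ≤ 1 := by
    rw [hβ, ← hn, mul_div_assoc', div_mul_eq_mul_div, div_le_one (by positivity)]
    have h1 : Q * F ≤ P * 1 := mul_le_mul hQP hF₁ hF₀.le hP0.le
    nlinarith
  set X : ℝ := Real.log (Δ * n / ε) with hX
  set T : ℝ := c * r * X / F with hT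
  have hTa : T = 91 * X / a := by
    have := (cStar_pos hθ).ne'
    rw [hT, ha, hc]
    field_simp
  have hX1 : 1 ≤ X := by
    have hpos : 0 < Δ * n / ε := by positivity
    rw [hX, Real.le_log_iff_exp_le hpos, le_div_iff₀ hε₀]
    have := Real.exp_one_lt_d9
    nlinarith
  have hT1 : 1 ≤ T := by
    rw [hTa, le_div_iff₀ ha0]
    linarith
  -- The load is inspected at time t + 1 = ⌊T⌋, after only t contracting steps; the floor and the
  -- initial step together cost at most 2.
  obtain ⟨t, ht⟩ : ∃ t : ℕ, ⌊T⌋₊ = t + 1 :=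
    Nat.exists_eq_add_one.2 (Nat.floor_pos.2 hT1)
  have htT : ((t + 1 : ℕ) : ℝ) ≤ T := ht ▸ Nat.floor_le (by linarith)
  have hTt : T ≤ t + 2 := by
    have := (Nat.lt_floor_add_one T).le
    rw [ht] at this
    push_cast at this
    linarith
  set E : Set (ℕ → Snapshot V) := {ω | ¬ IsBalanced (nearest (average Γ₀)) (ω (t + 1)).load}
    with hE
  have heval : Measurable fun ω : ℕ → Snapshot V => ω (t + 1) := measurable_pi_apply _
  have hmeas : MeasurableSet E :=
    heval (MeasurableSet.of_discrete
      (s := {s : Snapshot V | ¬ IsBalanced (nearest (average Γ₀)) s.load}))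
  have hbad : executionLaw p q A G₀ Γ₀ E ≤ ENNReal.ofReal ε := by
    refine (executionLaw_not_isBalanced_le p q A G₀ Γ₀ hF₀.le hA hβ
      (by rw [← hn]; linarith) t).trans (ENNReal.ofReal_le_ofReal ?_)
    rw [← hn, ← hΔ]
    exact pow_mul_le ha0 (haβ.trans hβn) (by linarith) (by linarith) hn2 hΔ1 hε₀ hε₁ hX
      (hTa ▸ hTt)
  calc ENNReal.ofReal (1 - ε) = 1 - ENNReal.ofReal ε := by
        rw [ENNReal.ofReal_sub _ hε₀.le, ENNReal.ofReal_one]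
    _ ≤ 1 - executionLaw p q A G₀ Γ₀ E := tsub_le_tsub_left hbad 1
    _ = executionLaw p q A G₀ Γ₀ Eᶜ := (prob_compl_eq_one_sub hmeas).symm
    _ ≤ _ := by
        refine measure_mono_ae ?_
        filter_upwards [hae] with ω hω hωE
        refine balancingTime_le (t := t + 1) ?_ htT
        rw [hω]
        exact not_not.1 hωE
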